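/- **Setting.** Let $\alpha>0$, $\sigma=1/(1+\alpha)$, $A(r)=r^\alpha$, $B(r)=(1+\alpha)r^{\alpha-1}$, $\langle x\rangle=(1+x^2)^{1/2}$, and let $H_0=\sigma_1(-i\partial_1-A_1)+\sigma_2(-i\partial_2-A_2)$ be the magnetic Dirac operator on $L^2(\mathbb R^2,\mathbb C^2)$ with $\mathbf A(\mathbf x)=A(|\mathbf x|)\,\mathbf e_\theta$. Write $\widehat w(r,j)=(2\pi)^{-1/2}\int_0^{2\pi}w(r\cos\theta,r\sin\theta)e^{-ij\theta}\,d\theta$ and identify $L^2(\mathbb R^2,\mathbb C^2)$ with $\bigoplus_{j\in\mathbb Z}L^2((0,\infty),r\,dr;\mathbb C^2)$ through $\psi\mapsto(\widehat{\psi^1}(\cdot,j),\,i\,\widehat{\psi^2}(\cdot,j+1))_{j}$. Let $\mathcal C$ be the space of sequences $(\varphi_j)_{j\in\mathbb Z}$, with $\varphi_j=0$ for all but finitely many $j$, of compactly supported continuous functions $\varphi_j:[0,\infty)\to\mathbb C^2$ that are smooth on $(0,\infty)$ and satisfy $|\varphi_j^{(k)}(r)|=O(r^N)$ as $r\downarrow0$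 for all $k,N$. Let $W\in L^2_{\rm loc}(\mathbb R^2,\mathbb C^{2\times2})$ be hermitian, and let $\beta\in(0,\infty]$, $\mu_*\in[0,1)$ and $v\in L^2_{\rm loc}([0,\infty),dr)$ be such that for almost every $r>0$ and all $j\in\mathbb Z$ $$\left\|\begin{pmatrix}\widehat{w}_{11}(r,j)&\widehat w_{12}(r,j-1)\\ \widehat w_{21}(r,j+1)&\widehat w_{22}(r,j)\end{pmatrix}\right\|\le v(r)e^{-\beta|j|},\qquad\text{and}\qquad \limsup_{r\to\infty}\frac{v_\beta(r)^2}{A(r)^2}=\mu_*,\quad v_\beta:=\coth(\beta/4)\,v$$ (for $\beta=\infty$: $e^{-\beta|j|}$ is $1$ if $j=0$ and $0$ otherwise, and $\coth(\beta/4)=1$). Let $\omega:=\big(\max(v_\beta^2-\mu_*A^2,0)\big)^{1/2}$ be the non-critical part of $v_\beta$. **Parameters.** Put $V_j^{\pm}(r)=\big(\tfrac{j+1/2\pm1/2}{r}-A(r)\big)^2\pm B(r)$, and let $V_j\ge t$ mean that $V_j^+\ge t$ and $V_j^-\ge t$. Let $\mu,\delta,\varepsilon_0\in(0,1)$ with $\mu>\mu_*$,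 and let $j_0,c>1$. Let $c_\mu\ge1$ be such that for all $c'\ge c_\mu$ and $j\in\mathbb Z$: $V_j(r)\ge\mu A(r)^2$ for $r\ge c'\langle j\rangle^\sigma$. Let $\delta_{\mu,c}\in(0,1)$ be such that for all $\delta'\in(0,\delta_{\mu,c}]$ and $|j|\ge2$: $V_j(r)\ge\mu A(2c|j|^\sigma)^2$ for $0<r\le\delta'|j|^\sigma$. Assume $c\ge c_\mu$, $\delta\le\delta_{\mu,c}$, and $\varepsilon_0\ge C_*\max\big(\tfrac1c,\tfrac1{\delta j_0^\sigma}\big)$, where $C_*>2$ is the constant in the following construction. For $0<a<b$ let $g_{a,b}:(0,\infty)\to[0,1]$ be smooth, equal to $0$ on $(0,a/2)$, monotone on $[a/2,a]$, equal to $1$ on $(a,b)$, monotone on $[b,2b)$ and equal to $0$ on $[2b,\infty)$, with $(1-g_{a,b}^2)^{1/2}$ smooth and $|g_{a,b}'|,\,|((1-g_{a,b}^2)^{1/2})'|\le C_*/a$; let $h_{a,b}$ be $1$ on $(0,b)$ and $g_{a,b}$ on $[b,\infty)$, with $(1-h_{a,b}^2)^{1/2}$ smooth and $|h_{a,b}'|\le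 C_*/b$. Let $\boldsymbol\chi=\bigoplus_j\chi_j$ with $\chi_j(r)=h_{\delta/2,2c}(r/\langle j\rangle^\sigma)$ for $|j|\le j_0$ and $\chi_j(r)=g_{\delta/2,2c}(r/|j|^\sigma)$ for $|j|>j_0$, and let $\boldsymbol\lambda=\bigoplus_j\lambda_j$ with $\lambda_j=A(2c\langle j\rangle^\sigma)$. **Theorem.** For all $\varepsilon_*,\varepsilon_1\in(0,1)$ there is $C_0>0$ such that $$W^2\;\le\;v_\beta^2\;\le\;\Big(\frac{\mu_*+\varepsilon_1+\varepsilon_*}{\mu}\Big)H_0^2+(\mu_*+\varepsilon_*)\,\boldsymbol\chi\boldsymbol\lambda^2\boldsymbol\chi+C_0$$ in the sense of quadratic forms on $\mathcal C$. Moreover, if $\omega$ is bounded (almost everywhere), the same holds, for some $C_0>0$, with $\varepsilon_*=\varepsilon_1=0$; and if $\limsup_{r\to\infty}|\omega(r)|=0$, the same holds, for every $\varepsilon_1\in(0,1)$ and some $C_0>0$, with $\varepsilon_*=0$. -/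

import Mathlib

open Set Filter Topology MeasureTheory
open scoped ENNReal ContDiff

noncomputable section

namespace DiracMag

/-! ## The plane, spinors, and the magnetic Dirac operator -/

/-- Spinors: `ℂ²` with its Euclidean norm. -/
abbrev Spinor : Type := EuclideanSpace ℂ (Fin 2)

/-- Action of a `2 × 2` matrix on a spinor. -/
def act (M : Matrix (Fin 2) (Fin 2) ℂ) (ψ : Spinor) : Spinor :=
  Matrix.toEuclideanCLM (𝕜 := ℂ) M ψ

/-- Operator norm of a `2 × 2` matrix with respect to the Euclidean norm of `ℂ²`. -/
def opNorm (M : Matrix (Fin 2) (Fin 2) ℂ) : ℝ :=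
  ‖Matrix.toEuclideanCLM (𝕜 := ℂ) M‖

/-- The Pauli matrix `σ₁`. -/
def pauli1 : Matrix (Fin 2) (Fin 2) ℂ := !![0, 1; 1, 0]

/-- The Pauli matrix `σ₂`. -/
def pauli2 : Matrix (Fin 2) (Fin 2) ℂ := !![0, -Complex.I; Complex.I, 0]

/-- The Euclidean length `r = |x|` of a point of the plane (the norm of `ℝ × ℝ` in Mathlib is
the sup norm, so it is not used). -/
def rad (x : ℝ × ℝ) : ℝ := Real.sqrt (x.1 ^ 2 + x.2 ^ 2)

/-- The phase `e^{iθ}` of a point `x = r (cos θ, sin θ)` of the plane, `x ≠ 0`. -/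
def phase (x : ℝ × ℝ) : ℂ := ((x.1 : ℂ) + (x.2 : ℂ) * Complex.I) / (rad x : ℂ)

/-- The Japanese bracket `⟨x⟩ = (1 + x²)^{1/2}`. -/
def bracket (x : ℝ) : ℝ := Real.sqrt (1 + x ^ 2)

/-- The exponent `σ = 1 / (1 + α)`. -/
def sig (α : ℝ) : ℝ := 1 / (1 + α)

/-- The radial profile `A(r) = r^α` of the magnetic vector potential. -/
def potA (α r : ℝ) : ℝ := r ^ α

/-- The rotationally symmetric magnetic field `B(r) = (1 + α) r^{α - 1}`. -/
def fieldB (α r : ℝ) : ℝ := (1 + α) * r ^ (α - 1)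

/-- `B` is the field whose flux through the centred disc of radius `r` is
`2π r^{α + 1} = 2π r A(r)`. -/
theorem two_pi_integral_fieldB {α : ℝ} (hα : 0 < α) {r : ℝ} (hr : 0 < r) :
    2 * Real.pi * ∫ s in (0 : ℝ)..r, s * fieldB α s = 2 * Real.pi * (r * potA α r) := by
  have h : ∫ s in (0 : ℝ)..r, s * fieldB α s = ∫ s in (0 : ℝ)..r, (1 + α) * s ^ α := by
    refine intervalIntegral.integral_congr_ae (Filter.Eventually.of_forall fun s hs => ?_)
    rw [Set.uIoc_of_le hr.le] at hs
    have h2 : s * s ^ (α - 1) = s ^ α := by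
      have h3 := Real.rpow_add hs.1 1 (α - 1)
      rw [Real.rpow_one] at h3
      rw [← h3]
      congr 1
      ring
    simp only [fieldB]
    rw [← h2]
    ring
  rw [h, intervalIntegral.integral_const_mul, integral_rpow (Or.inl (by linarith))]
  have h0 : (0 : ℝ) ^ (α + 1) = 0 := Real.zero_rpow (by linarith)
  have h1 : r ^ (α + 1) = r * r ^ α := by rw [Real.rpow_add hr, Real.rpow_one]; ring
  have h4 : (α + 1) ≠ 0 := by linarith
  rw [h0, h1, potA]
  field_simp
  ring

/-- First component of the vector potential `𝐀(x) = A(|x|) e_θ`. -/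
def vecA1 (α : ℝ) (x : ℝ × ℝ) : ℝ := potA α (rad x) * (-x.2 / rad x)

/-- Second component of the vector potential `𝐀(x) = A(|x|) e_θ`. -/
def vecA2 (α : ℝ) (x : ℝ × ℝ) : ℝ := potA α (rad x) * (x.1 / rad x)

/-- The magnetic Dirac operator `H₀ ψ = σ₁ (-i ∂₁ - A₁) ψ + σ₂ (-i ∂₂ - A₂) ψ`. -/
def dirac (α : ℝ) (ψ : ℝ × ℝ → Spinor) (x : ℝ × ℝ) : Spinor :=
  act pauli1 (-(Complex.I • fderiv ℝ ψ x (1, 0)) - (vecA1 α x : ℂ) • ψ x) +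
  act pauli2 (-(Complex.I • fderiv ℝ ψ x (0, 1)) - (vecA2 α x : ℂ) • ψ x)

/-! ## The core and the angular momentum decomposition -/

/-- The radial core: continuous compactly supported functions on `[0, ∞)` with values in `ℂ²`
that are smooth on `(0, ∞)` and all of whose derivatives are `O(r^N)` as `r ↓ 0`, for each `N`.
(Only the values on `[0, ∞)` matter.) -/
structure RadialCore (f : ℝ → Spinor) : Prop where
  continuousOn : ContinuousOn f (Ici 0)
  compactSupport : ∃ R : ℝ, ∀ r : ℝ, R ≤ r → f r = 0
  smooth : ContDiffOn ℝ ∞ f (Ioi 0)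
  vanish : ∀ k N : ℕ, (fun r : ℝ => iteratedDeriv k f r) =O[𝓝[>] 0] (fun r : ℝ => r ^ N)

/-- The core `𝒞`: sequences in the radial core with only finitely many angular momenta. -/
structure Core (φ : ℤ → ℝ → Spinor) : Prop where
  radial : ∀ j : ℤ, RadialCore (φ j)
  cutoff : ∃ N : ℕ, ∀ j : ℤ, (N : ℤ) < |j| → φ j = 0

/-- The function on the plane that corresponds to a sequence of radial functions under the
unitary identification of `L²(ℝ², ℂ²)` with `⨁_j L²((0, ∞), r dr; ℂ²)`, that is, the inverse of
`ψ ↦ (ψ̂¹(r, j), i ψ̂²(r, j + 1))_j`, where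
`ψ̂(r, j) = (2π)^{-1/2} ∫₀^{2π} ψ(r cos θ, r sin θ) e^{-ijθ} dθ`. -/
def toPlane (φ : ℤ → ℝ → Spinor) (x : ℝ × ℝ) : Spinor :=
  (((Real.sqrt (2 * Real.pi))⁻¹ : ℝ) : ℂ) •
    ∑' j : ℤ, !₂[φ j (rad x) 0 * phase x ^ j,
      -Complex.I * φ j (rad x) 1 * phase x ^ (j + 1)]

/-! ## Quadratic forms

All the forms below are non-negative, so they are given as integrals in `[0, ∞]`. -/

/-- The quadratic form `⟨φ, H₀² φ⟩ = ‖H₀ φ‖²`. -/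
def formDiracSq (α : ℝ) (φ : ℤ → ℝ → Spinor) : ℝ≥0∞ :=
  ∫⁻ x : ℝ × ℝ, ‖dirac α (toPlane φ) x‖ₑ ^ 2

/-- The quadratic form `⟨φ, W² φ⟩ = ‖W φ‖²` of a matrix-valued multiplication operator. -/
def formMulSq (W : ℝ × ℝ → Matrix (Fin 2) (Fin 2) ℂ) (φ : ℤ → ℝ → Spinor) : ℝ≥0∞ :=
  ∫⁻ x : ℝ × ℝ, ‖act (W x) (toPlane φ x)‖ₑ ^ 2

/-- The quadratic form `∑_j ∫₀^∞ m_j(r)² |φ_j(r)|² r dr` of the square of the direct sum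
`⨁_j m_j` of multiplication operators by real functions. -/
def formDiagSq (m : ℤ → ℝ → ℝ) (φ : ℤ → ℝ → Spinor) : ℝ≥0∞ :=
  ∑' j : ℤ, ∫⁻ r in Ioi (0 : ℝ), ENNReal.ofReal (m j r ^ 2) * ‖φ j r‖ₑ ^ 2 * ENNReal.ofReal r

/-! ## The perturbation -/

/-- Angular Fourier coefficient
`ŵ(r, j) = (2π)^{-1/2} ∫₀^{2π} w(r cos θ, r sin θ) e^{-ijθ} dθ`. -/
def angCoeff (w : ℝ × ℝ → ℂ) (r : ℝ) (j : ℤ) : ℂ :=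
  (((Real.sqrt (2 * Real.pi))⁻¹ : ℝ) : ℂ) *
    ∫ θ in (0 : ℝ)..(2 * Real.pi),
      w (r * Real.cos θ, r * Real.sin θ) * Complex.exp (-(Complex.I * (j : ℂ) * (θ : ℂ)))

/-- The matrix `W̃(r, j)` of angular Fourier coefficients of `W`, with the index shifts due to
the spin. -/
def angMatrix (W : ℝ × ℝ → Matrix (Fin 2) (Fin 2) ℂ) (r : ℝ) (j : ℤ) :
    Matrix (Fin 2) (Fin 2) ℂ :=
  !![angCoeff (fun x => W x 0 0) r j, angCoeff (fun x => W x 0 1) r (j - 1);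
     angCoeff (fun x => W x 1 0) r (j + 1), angCoeff (fun x => W x 1 1) r j]

/-- The factor `e^{-β|j|}`, for `0 < β ≤ ∞`; for `β = ∞` it is `1` at `j = 0` and `0` elsewhere. -/
def angDecay (β : ℝ≥0∞) (j : ℤ) : ℝ :=
  if β = ⊤ then (if j = 0 then 1 else 0) else Real.exp (-(β.toReal * |(j : ℝ)|))

/-- The factor `coth(β/4)`, for `0 < β ≤ ∞`; for `β = ∞` it is `1`. -/
def cothQuarter (β : ℝ≥0∞) : ℝ :=
  if β = ⊤ then 1 else Real.cosh (β.toReal / 4) / Real.sinh (β.toReal / 4)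

/-- `v_β = coth(β/4) v`. -/
def vBeta (β : ℝ≥0∞) (v : ℝ → ℝ) (r : ℝ) : ℝ := cothQuarter β * v r

/-- The assumptions on the perturbation `W`: it is hermitian and in `L²_loc(ℝ²)`; for a function
`v ∈ L²_loc([0, ∞))` (with Lebesgue measure) the angular Fourier coefficients of `W` are bounded
by `v(r) e^{-β|j|}`; and `limsup_{r → ∞} v_β(r)² / A(r)² = μ_* < 1`. The limsup is
taken in `[0, ∞]`. -/
structure Perturbation (α : ℝ) (β : ℝ≥0∞) (μs : ℝ) (v : ℝ → ℝ)
    (W : ℝ × ℝ → Matrix (Fin 2) (Fin 2) ℂ) : Prop where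
  β_pos : 0 < β
  μs_nonneg : 0 ≤ μs
  μs_lt_one : μs < 1
  locSq_W : ∀ K : Set (ℝ × ℝ), IsCompact K →
    ∀ i k : Fin 2, MemLp (fun x => W x i k) 2 (volume.restrict K)
  hermitian : ∀ᵐ x : ℝ × ℝ, (W x).IsHermitian
  locSq_v : ∀ R : ℝ, MemLp v 2 (volume.restrict (Icc 0 R))
  smooth_angle : ∀ᵐ r ∂(volume.restrict (Ioi (0 : ℝ))), ∀ j : ℤ,
    opNorm (angMatrix W r j) ≤ v r * angDecay β j
  control : limsup (fun r : ℝ => ENNReal.ofReal (vBeta β v r ^ 2 / potA α r ^ 2)) atTop =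
    ENNReal.ofReal μs

/-- The non-critical part `ω ≥ 0` of `v_β`, given by `v_β² = μ_* A² + ω²`; where
`v_β² < μ_* A²` it is `0`. -/
def omegaPart (α : ℝ) (β : ℝ≥0∞) (μs : ℝ) (v : ℝ → ℝ) (r : ℝ) : ℝ :=
  Real.sqrt (max (vBeta β v r ^ 2 - μs * potA α r ^ 2) 0)

/-! ## Effective potentials and the constants `c_μ`, `δ_{μ,c}` -/

/-- `V_j^+(r) = ((j + 1)/r - A(r))² + B(r)`; here `j + 1 = m_j + 1/2`. -/
def effPlus (α : ℝ) (j : ℤ) (r : ℝ) : ℝ :=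
  (((j : ℝ) + 1) / r - potA α r) ^ 2 + fieldB α r

/-- `V_j^-(r) = (j/r - A(r))² - B(r)`; here `j = m_j - 1/2`. -/
def effMinus (α : ℝ) (j : ℤ) (r : ℝ) : ℝ :=
  ((j : ℝ) / r - potA α r) ^ 2 - fieldB α r

/-- The inequality `V_j(r) ≥ t` between the diagonal matrix `V_j(r)` with entries `V_j^±(r)` and a
multiple of the identity. -/
def EffGe (α : ℝ) (j : ℤ) (r t : ℝ) : Prop := t ≤ effPlus α j r ∧ t ≤ effMinus α j r

/-- `cμ` is an admissible choice of `c_μ`. -/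
def IsCMu (α μ cμ : ℝ) : Prop :=
  1 ≤ cμ ∧ ∀ c : ℝ, cμ ≤ c → ∀ j : ℤ, ∀ r : ℝ, c * bracket j ^ sig α ≤ r →
    EffGe α j r (μ * potA α r ^ 2)

/-- `δμc` is an admissible choice of `δ_{μ,c}`. -/
def IsDeltaMu (α μ c δμc : ℝ) : Prop :=
  0 < δμc ∧ δμc < 1 ∧ ∀ δ : ℝ, 0 < δ → δ ≤ δμc → ∀ j : ℤ, 2 ≤ |j| →
    ∀ r : ℝ, 0 < r → r ≤ δ * |(j : ℝ)| ^ sig α →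
      EffGe α j r (μ * potA α (2 * c * |(j : ℝ)| ^ sig α) ^ 2)

/-! ## The partition of unity and the sequence `λ` -/

/-- The complement `(1 - g²)^{1/2}` of a localization function. -/
def perp (g : ℝ → ℝ) (r : ℝ) : ℝ := Real.sqrt (1 - g r ^ 2)

/-- The modification `h_{a,b}` of `g_{a,b}`: it is `1` on `(0, b)` and `g` on `[b, ∞)`. -/
def hCut (b : ℝ) (g : ℝ → ℝ) (r : ℝ) : ℝ := if r < b then 1 else g r

/-- `g` is an admissible cutoff function `g_{a,b}` on `(0, ∞)`, with derivative bounds given by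
the constant `Cs`. -/
structure IsCutoff (Cs a b : ℝ) (g : ℝ → ℝ) : Prop where
  smooth : ContDiffOn ℝ ∞ g (Ioi 0)
  mem_unit : ∀ r : ℝ, 0 < r → g r ∈ Icc (0 : ℝ) 1
  zero_left : ∀ r ∈ Ioo 0 (a / 2), g r = 0
  mono_left : MonotoneOn g (Icc (a / 2) a)
  one_mid : ∀ r ∈ Ioo a b, g r = 1
  anti_right : AntitoneOn g (Ico b (2 * b))
  zero_right : ∀ r : ℝ, 2 * b ≤ r → g r = 0
  smooth_perp : ContDiffOn ℝ ∞ (perp g) (Ioi 0)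
  deriv_le : ∀ r : ℝ, 0 < r → |deriv g r| ≤ Cs / a
  deriv_perp_le : ∀ r : ℝ, 0 < r → |deriv (perp g) r| ≤ Cs / a
  smooth_hCut_perp : ContDiffOn ℝ ∞ (perp (hCut b g)) (Ioi 0)
  deriv_hCut_le : ∀ r : ℝ, 0 < r → |deriv (hCut b g) r| ≤ Cs / b

/-- `χ` is (the first half of) a partition of unity built with respect to `(δ, c, j₀)`:
`χ_j(r) = h_{δ/2,2c}(r / ⟨j⟩^σ)` for `|j| ≤ j₀` and `χ_j(r) = g_{δ/2,2c}(r / |j|^σ)` for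
`|j| > j₀`. -/
def IsPartition (α Cs δ c j0 : ℝ) (χ : ℤ → ℝ → ℝ) : Prop :=
  ∃ g : ℝ → ℝ, IsCutoff Cs (δ / 2) (2 * c) g ∧
    ∀ j : ℤ, ∀ r : ℝ, 0 < r →
      χ j r = if |(j : ℝ)| ≤ j0 then hCut (2 * c) g (r / bracket j ^ sig α)
        else g (r / |(j : ℝ)| ^ sig α)

/-- `λ_j = A(2 c ⟨j⟩^σ)`. -/
def lam (α c : ℝ) (j : ℤ) : ℝ := potA α (2 * c * bracket j ^ sig α)

/-! ## The inequality -/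

/-- The chain of inequalities
`W² ≤ v_β² ≤ ((μ_* + ε₁ + ε_*) / μ) H₀² + (μ_* + ε_*) χ λ² χ + C₀`
between quadratic forms on the core `𝒞`. -/
def FormBound (α : ℝ) (β : ℝ≥0∞) (μs μ c : ℝ) (v : ℝ → ℝ)
    (W : ℝ × ℝ → Matrix (Fin 2) (Fin 2) ℂ) (χ : ℤ → ℝ → ℝ) (ε1 εs C0 : ℝ) : Prop :=
  ∀ φ : ℤ → ℝ → Spinor, Core φ →
    formMulSq W φ ≤ formDiagSq (fun _ => vBeta β v) φ ∧
    formDiagSq (fun _ => vBeta β v) φ ≤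
      ENNReal.ofReal ((μs + ε1 + εs) / μ) * formDiracSq α φ +
      ENNReal.ofReal (μs + εs) * formDiagSq (fun j r => lam α c j * χ j r) φ +
      ENNReal.ofReal C0 * formDiagSq (fun _ _ => 1) φ

end DiracMag

end

noncomputable section

namespace DiracMag

/-! ## Radial estimates -/

/-! In angular momentum channels, H₀ becomes a pair of first order operators D f = f' − q f with q =
s(m/r − A), where (s, m) = (1, j) for the upper and (−1, j+1) for the lower component
(`formDiracSq_eq`). Multiplication by v_β and by χλ is diagonal in the channels, so the second
inequality reduces to estimates in a single channel with constants independent of j.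

The main estimate is A² ≤ μ⁻¹ H₀² + χλ²χ + C (`exists_potential_form_bound`). Since (rq)' = −s r B,
integrating the total derivative of r q |u|² gives ∫ r|Du|² = ∫ r|u'|² + ∫ r(q² − sB)|u|², and q² −
sB is V_j^- for s = 1 and V_j^+ for s = −1. Apply this to u = sin(t) f with sin t supported where
V_j ≥ μA². Together with cos(t) f this is a partition of unity, and its localization error is
exactly t'²|f|² (`ScalarCore.eff_le`). The angle t is built in `exists_angle` so that cos t ≠ 0
forces χ_j = 1 and A ≤ λ_j. All transition layers have width bounded below uniformly in j, because
⟨j⟩^σ ≥ 1; hence |t'| ≤ K uniformly, and the error goes into the constant. Splitting A² = A² sin² t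
+ A² cos² t finishes this part.

Far out, v_β² ≤ (μ_* + ε_*)A², to which the main estimate applies. On a bounded interval v_β is only
in L²(dr); there r|f(r)|² is bounded by the radial energy with an arbitrarily small coefficient,
uniformly in m (`exists_local_sup_bound`), and this costs ε₁. If ω is bounded, v_β² ≤ μ_*A² + K²
everywhere and neither loss occurs; if ω → 0, the same holds only far out, and just ε_* disappears.

The inequality W² ≤ v_β² is pointwise. On almost every circle the Fourier series of W converges
absolutely, and conjugation by diag(1, e^{-iθ}) turns it into a series in the matrices of the
hypothesis. For β < ∞ this gives ‖W‖ ≤ v ∑ e^{-β|j|} = v coth(β/2) ≤ v_β, the factor (2π)^{-1/2} ≤ 1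
being discarded; for β = ∞ the sum is 1. -/

/-- Scalar components of functions in the radial core: the part of the regularity that the
radial estimates use. -/
structure ScalarCore (f : ℝ → ℂ) : Prop where
  support : ∃ R : ℝ, 0 < R ∧ ∀ r : ℝ, R ≤ r → f r = 0
  hasDeriv : ∀ r : ℝ, 0 < r → HasDerivAt f (deriv f r) r
  continuousOn_deriv : ContinuousOn (deriv f) (Ioi 0)
  bound : ∃ C : ℝ, 0 ≤ C ∧ (∀ r : ℝ, 0 ≤ r → ‖f r‖ ≤ C * r) ∧ ∀ r : ℝ, 0 < r → ‖deriv f r‖ ≤ C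

/-- The first order operator `f ↦ f' - s (m / r - A) f`. -/
def radOp (α s m : ℝ) (f : ℝ → ℂ) (r : ℝ) : ℂ :=
  deriv f r - ((s * (m / r - potA α r) : ℝ) : ℂ) * f r

theorem ScalarCore.continuousOn {f : ℝ → ℂ} (hf : ScalarCore f) : ContinuousOn f (Ici 0) := by
  obtain ⟨C, hC, hb, -⟩ := hf.bound
  intro r hr
  rcases eq_or_lt_of_le (show (0 : ℝ) ≤ r from hr) with h0 | h0
  · subst h0
    have hf0 : f 0 = 0 := by simpa using hb 0 le_rfl
    rw [ContinuousWithinAt, hf0, tendsto_zero_iff_norm_tendsto_zero]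
    refine squeeze_zero' (Eventually.of_forall fun _ => norm_nonneg _)
      (eventually_mem_nhdsWithin.mono fun x hx => hb x hx) ?_
    have : Tendsto (fun x : ℝ => C * x) (𝓝 0) (𝓝 (C * 0)) := (continuous_const.mul continuous_id).tendsto 0
    rw [mul_zero] at this
    exact this.mono_left nhdsWithin_le_nhds
  · exact (hf.hasDeriv r h0).continuousAt.continuousWithinAt

theorem continuous_potA {α : ℝ} (hα : 0 < α) : Continuous (potA α) :=
  Real.continuous_rpow_const hα.le

theorem potA_nonneg (α : ℝ) {r : ℝ} (hr : 0 ≤ r) : 0 ≤ potA α r := Real.rpow_nonneg hr _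

theorem potA_mono {α : ℝ} (hα : 0 < α) {r s : ℝ} (hr : 0 ≤ r) (hrs : r ≤ s) :
    potA α r ≤ potA α s := Real.rpow_le_rpow hr hrs hα.le

theorem mul_fieldB {α r : ℝ} (hr : 0 < r) : r * fieldB α r = (1 + α) * potA α r := by
  have h : r ^ α = r ^ (α - 1) * r := by rw [← Real.rpow_add_one hr.ne']; ring_nf
  simp only [fieldB, potA, h]; ring

/-- The right-hand side equals r B(r): this is how the magnetic field enters when r q is
differentiated. -/
theorem hasDerivAt_mul_potA {α r : ℝ} (hr : 0 < r) :
    HasDerivAt (fun x => x * potA α x) ((1 + α) * potA α r) r := by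
  have h := (hasDerivAt_id r).mul (Real.hasDerivAt_rpow_const (p := α) (Or.inl hr.ne'))
  refine h.congr_deriv ?_
  rw [← mul_fieldB hr]
  have h2 : r ^ α = r ^ (α - 1) * r := by rw [← Real.rpow_add_one hr.ne']; ring_nf
  simp only [id, fieldB, h2]; ring

theorem integrableOn_Icc_of_bounded {F : ℝ → ℝ} {b C : ℝ} (hF : ContinuousOn F (Ioi 0))
    (hC : ∀ r ∈ Ioc 0 b, |F r| ≤ C) : IntegrableOn F (Icc 0 b) := by
  rw [integrableOn_Icc_iff_integrableOn_Ioc]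
  refine IntegrableOn.of_bound (C := C) (by simp)
    ((hF.mono Ioc_subset_Ioi_self).aestronglyMeasurable measurableSet_Ioc) ?_
  exact (ae_restrict_mem measurableSet_Ioc).mono fun r hr => hC r hr

theorem ofReal_intervalIntegral_le_lintegral {P : ℝ → ℝ} {b : ℝ} (hb : 0 ≤ b)
    (hP : IntegrableOn P (Icc 0 b)) (hP0 : ∀ r, 0 < r → 0 ≤ P r) :
    ENNReal.ofReal (∫ r in (0 : ℝ)..b, P r) ≤ ∫⁻ r in Ioi (0 : ℝ), ENNReal.ofReal (P r) := by
  rw [intervalIntegral.integral_of_le hb, ofReal_integral_eq_lintegral_ofReal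
    (hP.mono_set Ioc_subset_Icc_self)
    ((ae_restrict_mem measurableSet_Ioc).mono fun r hr => hP0 r hr.1)]
  exact lintegral_mono_set Ioc_subset_Ioi_self

theorem lintegral_Ioi_eq_ofReal {L : ℝ → ℝ} {b : ℝ} (hb : 0 ≤ b) (hL : IntegrableOn L (Icc 0 b))
    (hL0 : ∀ r, 0 < r → 0 ≤ L r) (hLb : ∀ r, b ≤ r → L r = 0) :
    ∫⁻ r in Ioi (0 : ℝ), ENNReal.ofReal (L r) = ENNReal.ofReal (∫ r in (0 : ℝ)..b, L r) := by
  rw [intervalIntegral.integral_of_le hb, ofReal_integral_eq_lintegral_ofReal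
    (hL.mono_set Ioc_subset_Icc_self)
    ((ae_restrict_mem measurableSet_Ioc).mono fun r hr => hL0 r hr.1),
    ← Ioc_union_Ioi_eq_Ioi hb, lintegral_union measurableSet_Ioi
      (Ioc_disjoint_Ioi le_rfl)]
  rw [setLIntegral_congr_fun (g := fun _ => 0) measurableSet_Ioi
    (fun r hr => by simp [hLb r (le_of_lt hr)]), lintegral_zero, add_zero]

theorem ScalarCore.continuousOn_radOp {α s m : ℝ} (hα : 0 < α) {f : ℝ → ℂ} (hf : ScalarCore f) :
    ContinuousOn (radOp α s m f) (Ioi 0) := by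
  have hp := (continuous_potA hα).continuousOn (s := Ioi (0 : ℝ))
  have hc : ContinuousOn (fun r : ℝ => s * (m / r - potA α r)) (Ioi 0) :=
    continuousOn_const.mul ((continuousOn_const.div continuousOn_id
      fun r hr => (ne_of_gt hr)).sub hp)
  exact hf.continuousOn_deriv.sub ((Complex.continuous_ofReal.comp_continuousOn hc).mul
    (hf.continuousOn.mono Ioi_subset_Ici_self))

/-- The singular term (m/r) f stays bounded near 0 because |f| ≤ C r. -/
theorem ScalarCore.radOp_bound {α s m : ℝ} (hα : 0 < α) {f : ℝ → ℂ} (hf : ScalarCore f) (b : ℝ) :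
    ∃ C, 0 ≤ C ∧ ∀ r ∈ Ioc 0 b, ‖radOp α s m f r‖ ≤ C := by
  obtain ⟨C, hC, hb, hd⟩ := hf.bound
  refine ⟨C + |s| * (|m| + |b| * |potA α b|) * C, by positivity, fun r hr => ?_⟩
  refine (norm_sub_le _ _).trans (add_le_add (hd r hr.1) ?_)
  rw [norm_mul, Complex.norm_real, Real.norm_eq_abs, abs_mul]
  have h1 : |m / r - potA α r| * r ≤ |m| + |b| * |potA α b| := by
    have h2 : |m / r - potA α r| * r = |m - r * potA α r| := by
      rw [← abs_of_pos hr.1, ← abs_mul, abs_of_pos hr.1]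
      congr 1; field_simp [hr.1.ne']
    rw [h2]
    refine (abs_sub _ _).trans (add_le_add le_rfl ?_)
    rw [abs_mul, abs_of_pos hr.1, abs_of_nonneg (potA_nonneg α hr.1.le)]
    exact mul_le_mul (hr.2.trans (le_abs_self b)) ((potA_mono hα hr.1.le hr.2).trans
      (le_abs_self _)) (potA_nonneg α hr.1.le) (abs_nonneg b)
  calc |s| * |m / r - potA α r| * ‖f r‖ ≤ |s| * |m / r - potA α r| * (C * r) := by
        gcongr; exact hb r hr.1.le
    _ = |s| * (|m / r - potA α r| * r) * C := by ring
    _ ≤ _ := by gcongr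

/-- The energy density controlling the radial estimates is integrable. -/
theorem ScalarCore.integrableOn_energy {α s m : ℝ} (hα : 0 < α) {f : ℝ → ℂ} (hf : ScalarCore f)
    (b η K : ℝ) :
    IntegrableOn (fun r => r * (η * ‖radOp α s m f r‖ ^ 2 + K * ‖f r‖ ^ 2)) (Icc 0 b) := by
  obtain ⟨C, hC, hCg⟩ := hf.radOp_bound hα (s := s) (m := m) b
  obtain ⟨D, hD, hb, -⟩ := hf.bound
  refine integrableOn_Icc_of_bounded (C := |b| * (|η| * C ^ 2 + |K| * (D * |b|) ^ 2)) ?_ ?_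
  · have h1 := hf.continuousOn_radOp (s := s) (m := m) hα
    have h2 := hf.continuousOn.mono Ioi_subset_Ici_self
    exact continuousOn_id.mul ((continuousOn_const.mul (h1.norm.pow 2)).add
      (continuousOn_const.mul (h2.norm.pow 2)))
  · intro r hr
    have hrb : r ≤ |b| := hr.2.trans (le_abs_self b)
    rw [abs_mul, abs_of_pos hr.1]
    refine mul_le_mul hrb ((abs_add_le _ _).trans ?_) (abs_nonneg _) (abs_nonneg _)
    rw [abs_mul, abs_mul, abs_of_nonneg (sq_nonneg ‖radOp α s m f r‖),
      abs_of_nonneg (sq_nonneg ‖f r‖)]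
    have h3 : ‖f r‖ ≤ D * |b| := (hb r hr.1.le).trans (by gcongr)
    have h4 := hCg r hr
    gcongr

theorem ScalarCore.hasDerivAt_norm_sq {α s m : ℝ} {f : ℝ → ℂ} (hf : ScalarCore f) {r : ℝ}
    (hr : 0 < r) :
    HasDerivAt (fun x => ‖f x‖ ^ 2) (2 * (inner ℝ (f r) (radOp α s m f r) +
      s * (m / r - potA α r) * ‖f r‖ ^ 2)) r := by
  refine (hf.hasDeriv r hr).norm_sq.congr_deriv ?_
  have : deriv f r = radOp α s m f r + (s * (m / r - potA α r)) • f r := by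
    simp [radOp]
  rw [this, inner_add_right, inner_smul_right, real_inner_self_eq_norm_sq]

/-- The expression is ‖x g + y f‖² expanded; every completed square below is an instance. -/
theorem quadratic_nonneg (f g : ℂ) (x y : ℝ) :
    0 ≤ x ^ 2 * ‖g‖ ^ 2 + 2 * x * y * inner ℝ f g + y ^ 2 * ‖f‖ ^ 2 := by
  have h := norm_add_sq_real (x • g) (y • f)
  rw [inner_smul_left, inner_smul_right, norm_smul, norm_smul, real_inner_comm] at h
  simp only [mul_pow, Real.norm_eq_abs, sq_abs, conj_trivial] at h
  nlinarith [sq_nonneg ‖x • g + y • f‖]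

/-- Lower bound on the radial Dirac operator by the effective potential, on a region where
that potential dominates `μ A²`. The region is cut out by `sin (t r)`. -/
theorem ScalarCore.eff_le {α s m μ K : ℝ} (hα : 0 < α) (hs : s ^ 2 = 1) (hμ : 0 ≤ μ)
    {f : ℝ → ℂ} (hf : ScalarCore f) {t t' : ℝ → ℝ} (ht : ∀ r, HasDerivAt t (t' r) r)
    (htK : ∀ r, |t' r| ≤ K)
    (hV : ∀ r, 0 < r → Real.sin (t r) ≠ 0 →
      μ * potA α r ^ 2 ≤ (m / r - potA α r) ^ 2 - s * fieldB α r) :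
    ∫⁻ r in Ioi (0 : ℝ), ENNReal.ofReal (μ * potA α r ^ 2 * Real.sin (t r) ^ 2 * ‖f r‖ ^ 2 * r) ≤
      ∫⁻ r in Ioi (0 : ℝ), ENNReal.ofReal (r * (1 * ‖radOp α s m f r‖ ^ 2 + K ^ 2 * ‖f r‖ ^ 2)) := by
  obtain ⟨b, hb, hfb⟩ := hf.support
  obtain ⟨D, hD, hDb, -⟩ := hf.bound
  have htc : Continuous t := continuous_iff_continuousAt.2 fun r => (ht r).continuousAt
  have hsin : Continuous fun r => Real.sin (t r) := Real.continuous_sin.comp htc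
  have hA := continuous_potA hα
  have hfc := hf.continuousOn
  have hPi := hf.integrableOn_energy (s := s) (m := m) hα b 1 (K ^ 2)
  set P := fun r => r * (1 * ‖radOp α s m f r‖ ^ 2 + K ^ 2 * ‖f r‖ ^ 2) with hP
  set L := fun r => μ * potA α r ^ 2 * Real.sin (t r) ^ 2 * ‖f r‖ ^ 2 * r with hL
  have hLc : ContinuousOn L (Ici 0) := by
    refine ContinuousOn.mul (ContinuousOn.mul ?_ (hfc.norm.pow 2)) continuousOn_id
    exact (Continuous.mul (continuous_const.mul (hA.pow 2)) (hsin.pow 2)).continuousOn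
  have hLi : IntegrableOn L (Icc 0 b) :=
    (hLc.mono Icc_subset_Ici_self).integrableOn_Icc
  have hL0 : ∀ r, 0 < r → 0 ≤ L r := fun r hr => by
    simp only [hL]; have := hr.le; positivity
  -- This is −r q |sin(t) f|², the boundary term of the integration by parts. It vanishes at 0,
  -- where f = 0, and at b, beyond the support. Hence G' ≤ P − L on (0, b) already yields ∫ L ≤ ∫ P.
  set G := fun r => -(s * (m - r * potA α r) * Real.sin (t r) ^ 2 * ‖f r‖ ^ 2) with hG
  have hf0 : f 0 = 0 := by simpa using hDb 0 le_rfl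
  have key := intervalIntegral.sub_le_integral_of_hasDeriv_right_of_le (g := G)
    (g' := fun r => -((s * (-((1 + α) * potA α r)) * Real.sin (t r) ^ 2 + s * (m - r * potA α r) *
      (2 * Real.sin (t r) * (Real.cos (t r) * t' r))) * ‖f r‖ ^ 2 +
      s * (m - r * potA α r) * Real.sin (t r) ^ 2 *
        (2 * (inner ℝ (f r) (radOp α s m f r) + s * (m / r - potA α r) * ‖f r‖ ^ 2))))
    (φ := fun r => P r - L r) hb.le ?_ ?_ (hPi.sub hLi) ?_
  · have e1 : G b - G 0 = 0 := by simp [hG, hfb b le_rfl, hf0]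
    rw [e1, intervalIntegral.integral_sub
      ((intervalIntegrable_iff_integrableOn_Icc_of_le hb.le).2 hPi)
      ((intervalIntegrable_iff_integrableOn_Icc_of_le hb.le).2 hLi)] at key
    rw [lintegral_Ioi_eq_ofReal hb.le hLi hL0 (fun r hr => by simp [hL, hfb r hr])]
    refine le_trans (ENNReal.ofReal_le_ofReal (sub_nonneg.1 key)) ?_
    refine ofReal_intervalIntegral_le_lintegral hb.le hPi fun r hr => ?_
    simp only [hP]; have := hr.le; positivity
  · refine ContinuousOn.neg (ContinuousOn.mul (Continuous.continuousOn ?_)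
      ((hfc.mono Icc_subset_Ici_self).norm.pow 2))
    fun_prop
  · intro r hr
    refine HasDerivAt.hasDerivWithinAt (HasDerivAt.neg ?_)
    have h1 : HasDerivAt (fun r => s * (m - r * potA α r)) (s * (-((1 + α) * potA α r))) r := by
      have := ((hasDerivAt_mul_potA (α := α) hr.1).const_sub m).const_mul s
      exact this
    have h2 : HasDerivAt (fun r => Real.sin (t r) ^ 2)
        (2 * Real.sin (t r) * (Real.cos (t r) * t' r)) r := by
      have := ((ht r).sin).pow 2
      exact this.congr_deriv (by simp)
    exact (h1.mul h2).mul (hf.hasDerivAt_norm_sq hr.1)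
  · intro r hr
    have hr0 := hr.1
    set q := s * (m / r - potA α r) with hq
    have hrq : s * (m - r * potA α r) = r * q := by rw [hq]; field_simp
    have hq2 : q ^ 2 = (m / r - potA α r) ^ 2 := by rw [hq, mul_pow, hs, one_mul]
    -- With f' = Df + q f, the first square is |(sin(t) f)'|² and the second is |D(cos(t) f)|².
    -- These are the two non-negative terms discarded from the exact identity.
    have n1 := quadratic_nonneg (f r) (radOp α s m f r) (Real.sin (t r))
      (Real.cos (t r) * t' r + q * Real.sin (t r))
    have n2 := quadratic_nonneg (f r) (radOp α s m f r) (Real.cos (t r))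
      (-(Real.sin (t r) * t' r))
    have hcs := Real.sin_sq_add_cos_sq (t r)
    have htt : t' r ^ 2 ≤ K ^ 2 := sq_le_sq' (abs_le.1 (htK r)).1 (abs_le.1 (htK r)).2
    have hV' : μ * potA α r ^ 2 * Real.sin (t r) ^ 2 * r ≤
        (r * q ^ 2 - s * ((1 + α) * potA α r)) * Real.sin (t r) ^ 2 := by
      by_cases h0 : Real.sin (t r) = 0
      · simp [h0]
      · have h := hV r hr0 h0
        rw [← hq2] at h
        rw [← mul_fieldB hr0]
        have h3 := mul_le_mul_of_nonneg_right h (mul_nonneg hr0.le (sq_nonneg (Real.sin (t r))))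
        linarith
    have hN := sq_nonneg ‖f r‖
    have h4 := mul_le_mul_of_nonneg_right hV' hN
    have h5 := mul_nonneg hr0.le (add_nonneg n1 n2)
    have h6 : r * (t' r ^ 2 * ‖f r‖ ^ 2) ≤ r * (K ^ 2 * ‖f r‖ ^ 2) := by gcongr
    simp only [hP, hL, hrq]
    set S := Real.sin (t r)
    set C := Real.cos (t r)
    set N := ‖f r‖ ^ 2
    set a := ‖radOp α s m f r‖ ^ 2
    set I := inner ℝ (f r) (radOp α s m f r)
    have hC2 : C ^ 2 = 1 - S ^ 2 := by linarith
    have e : r * ((S ^ 2 * a + 2 * S * (C * t' r + q * S) * I + (C * t' r + q * S) ^ 2 * N) +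
        (C ^ 2 * a + 2 * C * (-(S * t' r)) * I + (-(S * t' r)) ^ 2 * N)) =
        r * (a + t' r ^ 2 * N + 2 * q * S ^ 2 * I + 2 * q * S * C * t' r * N +
          q ^ 2 * S ^ 2 * N) := by
      linear_combination (r * (a + t' r ^ 2 * N)) * hcs
    rw [e] at h5
    linarith

/-! ### Smooth steps and the local sup bound -/

theorem exists_abs_deriv_smoothTransition_le :
    ∃ K : ℝ, 0 ≤ K ∧ ∀ x, |deriv Real.smoothTransition x| ≤ K := by
  have hc : Continuous (deriv Real.smoothTransition) :=
    (Real.smoothTransition.contDiff (n := 1)).continuous_deriv le_rfl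
  obtain ⟨K, hK⟩ := (isCompact_Icc (a := (0 : ℝ)) (b := 1)).exists_bound_of_continuousOn hc.continuousOn
  have hK0 : 0 ≤ K := (norm_nonneg _).trans (hK 0 (by simp))
  refine ⟨K, hK0, fun x => ?_⟩
  rcases lt_or_ge x 0 with h | h
  · have : Real.smoothTransition =ᶠ[𝓝 x] fun _ => 0 := by
      filter_upwards [Iio_mem_nhds h] with y hy
      exact Real.smoothTransition.zero_of_nonpos (le_of_lt hy)
    simpa [this.deriv_eq] using hK0
  rcases lt_or_ge 1 x with h' | h'
  · have : Real.smoothTransition =ᶠ[𝓝 x] fun _ => 1 := by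
      filter_upwards [Ioi_mem_nhds h'] with y hy
      exact Real.smoothTransition.one_of_one_le (le_of_lt hy)
    simpa [this.deriv_eq] using hK0
  · exact hK x ⟨h, h'⟩

theorem hasDerivAt_smoothTransition (x : ℝ) :
    HasDerivAt Real.smoothTransition (deriv Real.smoothTransition x) x :=
  ((Real.smoothTransition.contDiff (n := 1)).differentiable (by norm_num) x).hasDerivAt

/-- Local sup bound, uniform in the angular momentum: `r |f(r)|²` for `r ≤ R` is bounded by the
radial Dirac energy with an arbitrarily small constant. -/
theorem exists_local_sup_bound {α : ℝ} (hα : 0 < α) {R : ℝ} (hR : 0 < R) {η : ℝ} (hη : 0 < η) :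
    ∃ C : ℝ, 0 ≤ C ∧ ∀ (s m : ℝ) (_ : s ^ 2 = 1) (f : ℝ → ℂ) (_ : ScalarCore f), ∀ r ∈ Ioc 0 R,
      ENNReal.ofReal (r * ‖f r‖ ^ 2) ≤ ∫⁻ x in Ioi (0 : ℝ),
        ENNReal.ofReal (x * (η * ‖radOp α s m f x‖ ^ 2 + C * ‖f x‖ ^ 2)) := by
  obtain ⟨K, hK, hKb⟩ := exists_abs_deriv_smoothTransition_le
  have hA2 := potA_nonneg α (show 0 ≤ 2 * R by positivity)
  -- K/R is the slope of a cutoff descending over [R, 2R], 2A(2R) bounds the potential term, and 1/η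
  -- is the price of splitting 2 Re⟨f, Df⟩ with weight η on |Df|².
  refine ⟨K / R + 2 * potA α (2 * R) + 1 / η, by positivity, fun s m hs f hf r hr => ?_⟩
  set C := K / R + 2 * potA α (2 * R) + 1 / η with hC
  obtain ⟨D, hD, hDb, -⟩ := hf.bound
  have hf0 : f 0 = 0 := by simpa using hDb 0 le_rfl
  have hPi := hf.integrableOn_energy (s := s) (m := m) hα (2 * R) η C
  set P := fun r => r * (η * ‖radOp α s m f r‖ ^ 2 + C * ‖f r‖ ^ 2) with hP
  have hP0 : ∀ r, 0 < r → 0 ≤ P r := fun r hr => by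
    have := hr.le
    have : 0 ≤ C := by positivity
    simp only [hP]; positivity
  have hHd : ∀ x, 0 < x → HasDerivAt (fun x => x * ‖f x‖ ^ 2) ((1 + 2 * s * m) * ‖f x‖ ^ 2 -
      2 * s * x * potA α x * ‖f x‖ ^ 2 + 2 * x * inner ℝ (f x) (radOp α s m f x)) x := by
    intro x hx
    refine ((hasDerivAt_id x).mul (hf.hasDerivAt_norm_sq (α := α) (s := s) (m := m) hx)).congr_deriv ?_
    simp only [id]
    field_simp
    ring
  have hHc : ContinuousOn (fun x => x * ‖f x‖ ^ 2) (Ici 0) :=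
    continuousOn_id.mul (hf.continuousOn.norm.pow 2)
  have hs1 : |s| = 1 := by rwa [← sq_eq_sq₀ (abs_nonneg s) zero_le_one, sq_abs, one_pow]
  have hI : ∀ x, |2 * inner ℝ (f x) (radOp α s m f x)| ≤
      η * ‖radOp α s m f x‖ ^ 2 + 1 / η * ‖f x‖ ^ 2 := by
    intro x
    have n1 := quadratic_nonneg (f x) (radOp α s m f x) η 1
    have n2 := quadratic_nonneg (f x) (radOp α s m f x) η (-1)
    have e : η * ‖radOp α s m f x‖ ^ 2 + 1 / η * ‖f x‖ ^ 2 =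
      (η ^ 2 * ‖radOp α s m f x‖ ^ 2 + ‖f x‖ ^ 2) / η := by field_simp
    rw [e, le_div_iff₀ hη, ← abs_of_pos hη, ← abs_mul, abs_of_pos hη, abs_le]
    constructor <;> linarith
  have hsA : ∀ x ∈ Ioc 0 (2 * R), |2 * s * x * potA α x * ‖f x‖ ^ 2| ≤
      x * (2 * potA α (2 * R) * ‖f x‖ ^ 2) := by
    intro x hx
    have h1 := potA_mono hα hx.1.le hx.2
    have h2 := potA_nonneg α hx.1.le
    have h3 := hx.1.le
    rw [show 2 * s * x * potA α x * ‖f x‖ ^ 2 = s * (x * (2 * potA α x * ‖f x‖ ^ 2)) by ring,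
      abs_mul, hs1, one_mul, abs_of_nonneg (by positivity)]
    gcongr
  have hKR : 0 ≤ K / R := by positivity
  -- The only m-dependent term in the derivative of x|f|² is (1 + 2sm)|f|². It is dropped by
  -- integrating from the side where its sign helps: from 0, where x|f|² vanishes, if it is
  -- non-positive, and inwards from 2R with a cutoff otherwise. This makes the constant independent
  -- of m.
  rcases le_total (1 + 2 * s * m) 0 with hsm | hsm
  · have key := intervalIntegral.sub_le_integral_of_hasDeriv_right_of_le hr.1.le
      (hHc.mono Icc_subset_Ici_self) (fun x hx => (hHd x hx.1).hasDerivWithinAt)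
      (hPi.mono_set (Icc_subset_Icc_right (by linarith [hr.2]))) ?_
    · rw [hf0] at key
      refine le_trans (ENNReal.ofReal_le_ofReal ?_) (ofReal_intervalIntegral_le_lintegral hr.1.le
        (hPi.mono_set (Icc_subset_Icc_right (by linarith [hr.2]))) hP0)
      simpa using key
    · intro x hx
      have h1 := mul_nonpos_of_nonpos_of_nonneg hsm (sq_nonneg ‖f x‖)
      have h2 := (abs_le.1 (hsA x ⟨hx.1, by linarith [hx.2, hr.2]⟩)).1
      have h3 := mul_le_mul_of_nonneg_left (le_of_abs_le (hI x)) hx.1.le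
      have h4 := mul_nonneg (mul_nonneg hx.1.le hKR) (sq_nonneg ‖f x‖)
      simp only [hP, hC]
      linarith
  · set ζ := fun x => Real.smoothTransition (2 - x / R) with hζ
    have hζd : ∀ x, HasDerivAt ζ (deriv Real.smoothTransition (2 - x / R) * (-(1 / R))) x := by
      intro x
      exact (hasDerivAt_smoothTransition _).comp x (((hasDerivAt_id x).div_const R).const_sub 2)
    have hζc : Continuous ζ := continuous_iff_continuousAt.2 fun x => (hζd x).continuousAt
    have hr2 : r ≤ 2 * R := by linarith [hr.2]
    have hsub : Icc r (2 * R) ⊆ Icc 0 (2 * R) := Icc_subset_Icc_left hr.1.le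
    have key := intervalIntegral.sub_le_integral_of_hasDeriv_right_of_le hr2
      (hζc.continuousOn.mul (hHc.mono fun x hx => hr.1.le.trans hx.1)).neg
      (fun x hx => ((hζd x).mul (hHd x (hr.1.trans hx.1))).neg.hasDerivWithinAt)
      (hPi.mono_set hsub) ?_
    · have e1 : ζ (2 * R) = 0 := Real.smoothTransition.zero_of_nonpos (by field_simp; norm_num)
      have e2 : ζ r = 1 := Real.smoothTransition.one_of_one_le (by
        have := (div_le_one hR).2 hr.2
        linarith)
      refine le_trans (ENNReal.ofReal_le_ofReal ?_) (ofReal_intervalIntegral_le_lintegral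
        (by positivity) hPi hP0)
      simp only [Pi.neg_apply, Pi.mul_apply, e1, e2, zero_mul, one_mul, neg_zero, zero_sub, neg_neg] at key
      refine key.trans ?_
      rw [intervalIntegral.integral_of_le hr2, intervalIntegral.integral_of_le (by positivity)]
      refine setIntegral_mono_set (hPi.mono_set Ioc_subset_Icc_self) ?_
        (Ioc_subset_Ioc_left hr.1.le).eventuallyLE
      exact (ae_restrict_mem measurableSet_Ioc).mono fun x hx => hP0 x hx.1
    · intro x hx
      have hx0 := hr.1.trans hx.1
      have z0 : 0 ≤ ζ x := Real.smoothTransition.nonneg _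
      have z1 : ζ x ≤ 1 := Real.smoothTransition.le_one _
      have h1 := mul_nonneg hsm (sq_nonneg ‖f x‖)
      have h2 := (abs_le.1 (hsA x ⟨hx0, hx.2.le⟩)).2
      have h3 := mul_le_mul_of_nonneg_left (neg_le_of_abs_le (hI x)) hx0.le
      have h4 : -(deriv Real.smoothTransition (2 - x / R) * (-(1 / R))) ≤ K / R := by
        have := le_of_abs_le (hKb (2 - x / R))
        rw [mul_neg, neg_neg, mul_one_div]
        gcongr
      have h5 := mul_le_mul_of_nonneg_right h4 (mul_nonneg hx0.le (sq_nonneg ‖f x‖))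
      have h6 : 0 ≤ x * (2 * potA α (2 * R) * ‖f x‖ ^ 2) + x * (η * ‖radOp α s m f x‖ ^ 2 +
          1 / η * ‖f x‖ ^ 2) := by positivity
      have h7 := mul_le_mul_of_nonneg_right z1 h6
      have h8 : -((1 + 2 * s * m) * ‖f x‖ ^ 2 - 2 * s * x * potA α x * ‖f x‖ ^ 2 +
          2 * x * inner ℝ (f x) (radOp α s m f x)) ≤
          x * (2 * potA α (2 * R) * ‖f x‖ ^ 2) + x * (η * ‖radOp α s m f x‖ ^ 2 +
          1 / η * ‖f x‖ ^ 2) := by linarith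
      have h9 := mul_le_mul_of_nonneg_left h8 z0
      simp only [hP, hC]
      linarith

/-! ### Regularity of the components of core functions -/

theorem RadialCore.hasDerivAt {f : ℝ → Spinor} (hf : RadialCore f) {r : ℝ} (hr : 0 < r) :
    HasDerivAt f (deriv f r) r :=
  ((hf.smooth.contDiffAt (Ioi_mem_nhds hr)).differentiableAt (by simp)).hasDerivAt

theorem RadialCore.hasDerivAt_apply {f : ℝ → Spinor} (hf : RadialCore f) (i : Fin 2) {r : ℝ}
    (hr : 0 < r) : HasDerivAt (fun x => f x i) (deriv f r i) r :=
  (PiLp.proj (𝕜 := ℝ) 2 (fun _ : Fin 2 => ℂ) i).hasFDerivAt.comp_hasDerivAt r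
    (hf.hasDerivAt hr)

theorem RadialCore.eq_zero_at_zero {f : ℝ → Spinor} (hf : RadialCore f) : f 0 = 0 := by
  have h1 : Tendsto f (𝓝[>] 0) (𝓝 (f 0)) :=
    (hf.continuousOn 0 self_mem_Ici).mono_left (nhdsWithin_mono _ Ioi_subset_Ici_self)
  have h2 : Tendsto f (𝓝[>] 0) (𝓝 0) := by
    have h := hf.vanish 0 1
    simp only [iteratedDeriv_zero, pow_one] at h
    exact h.trans_tendsto (tendsto_id.mono_left nhdsWithin_le_nhds)
  exact tendsto_nhds_unique h1 h2

theorem RadialCore.continuousOn_deriv {f : ℝ → Spinor} (hf : RadialCore f) :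
    ContinuousOn (deriv f) (Ioi 0) :=
  hf.smooth.continuousOn_deriv_of_isOpen isOpen_Ioi (by simp)

/-- Near 0 this is the vanishing condition for (k, N) = (0, 1) and (1, 0). On the remaining compact
interval it follows from continuity, and beyond it f is zero. -/
theorem RadialCore.bound {f : ℝ → Spinor} (hf : RadialCore f) :
    ∃ C : ℝ, 0 ≤ C ∧ (∀ r : ℝ, 0 ≤ r → ‖f r‖ ≤ C * r) ∧ ∀ r : ℝ, 0 < r → ‖deriv f r‖ ≤ C := by
  obtain ⟨R, hR⟩ := hf.compactSupport
  obtain ⟨C1, hC1, h1⟩ := (hf.vanish 0 1).exists_pos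
  obtain ⟨C2, hC2, h2⟩ := (hf.vanish 1 0).exists_pos
  simp only [iteratedDeriv_zero, iteratedDeriv_one, pow_one, pow_zero] at h1 h2
  obtain ⟨ε, hε, hε12⟩ := (mem_nhdsGT_iff_exists_Ioo_subset (a := (0 : ℝ))).1
    (inter_mem h1.bound h2.bound)
  have hε : 0 < ε := hε
  set R' := max R ε
  have hsub : Icc ε R' ⊆ Ioi 0 := fun r hr => hε.trans_le hr.1
  obtain ⟨M1, hM1⟩ := (isCompact_Icc (a := ε) (b := R')).exists_bound_of_continuousOn
    (hf.continuousOn.mono (hsub.trans Ioi_subset_Ici_self))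
  obtain ⟨M2, hM2⟩ := (isCompact_Icc (a := ε) (b := R')).exists_bound_of_continuousOn
    (hf.continuousOn_deriv.mono hsub)
  have hεm : ε ∈ Icc ε R' := ⟨le_rfl, le_max_right _ _⟩
  have hM10 : 0 ≤ M1 := (norm_nonneg _).trans (hM1 ε hεm)
  have hM20 : 0 ≤ M2 := (norm_nonneg _).trans (hM2 ε hεm)
  refine ⟨C1 + C2 + M1 / ε + M2, by positivity, fun r hr => ?_, fun r hr => ?_⟩
  · rcases eq_or_lt_of_le hr with h0 | h0
    · simp [← h0, hf.eq_zero_at_zero]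
    rcases lt_or_ge r ε with h | h
    · have := (hε12 ⟨h0, h⟩).1
      simp only [mem_ofPred_eq, Real.norm_eq_abs, abs_of_pos h0] at this
      refine this.trans ?_
      have : 0 ≤ C2 + M1 / ε + M2 := by positivity
      nlinarith
    rcases le_or_gt r R' with h' | h'
    · refine (hM1 r ⟨h, h'⟩).trans ?_
      have h3 : M1 ≤ M1 / ε * r := by
        rw [div_mul_eq_mul_div, le_div_iff₀ hε]; gcongr
      have : 0 ≤ C1 + C2 + M2 := by positivity
      nlinarith
    · rw [hR r ((le_max_left _ _).trans h'.le), norm_zero]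
      positivity
  · rcases lt_or_ge r ε with h | h
    · have := (hε12 ⟨hr, h⟩).2
      simp only [mem_ofPred_eq, norm_one, mul_one] at this
      have h4 : 0 ≤ M1 / ε := by positivity
      linarith
    have h4 : 0 ≤ M1 / ε := by positivity
    rcases le_or_gt r R' with h' | h'
    · have := hM2 r ⟨h, h'⟩
      linarith
    · have : f =ᶠ[𝓝 r] fun _ => 0 := by
        filter_upwards [Ioi_mem_nhds h'] with y hy
        exact hR y ((le_max_left _ _).trans (le_of_lt hy))
      rw [this.deriv_eq]
      simp only [deriv_const, norm_zero]
      positivity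

theorem RadialCore.scalar {f : ℝ → Spinor} (hf : RadialCore f) (i : Fin 2) :
    ScalarCore (fun r => f r i) := by
  have hd : ∀ r, 0 < r → deriv (fun r => f r i) r = deriv f r i :=
    fun r hr => (hf.hasDerivAt_apply i hr).deriv
  constructor
  · obtain ⟨R, hR⟩ := hf.compactSupport
    exact ⟨max R 1, by positivity, fun r hr => by simp [hR r ((le_max_left _ _).trans hr)]⟩
  · intro r hr
    rw [hd r hr]
    exact hf.hasDerivAt_apply i hr
  · refine ContinuousOn.congr (f := fun r => deriv f r i) ?_ hd
    exact (PiLp.proj (𝕜 := ℝ) 2 (fun _ : Fin 2 => ℂ) i).continuous.comp_continuousOn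
      hf.continuousOn_deriv
  · obtain ⟨C, hC, h1, h2⟩ := hf.bound
    refine ⟨C, hC, fun r hr => (PiLp.norm_apply_le _ i).trans (h1 r hr), fun r hr => ?_⟩
    rw [hd r hr]
    exact (PiLp.norm_apply_le _ i).trans (h2 r hr)

/-! ## Polar coordinates and angular orthogonality -/

theorem rad_polar {r : ℝ} (hr : 0 ≤ r) (θ : ℝ) : rad (r * Real.cos θ, r * Real.sin θ) = r := by
  have : (r * Real.cos θ) ^ 2 + (r * Real.sin θ) ^ 2 = r ^ 2 := by
    linear_combination r ^ 2 * Real.sin_sq_add_cos_sq θ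
  simp only [rad, this, Real.sqrt_sq hr]

theorem phase_polar {r : ℝ} (hr : 0 < r) (θ : ℝ) :
    phase (r * Real.cos θ, r * Real.sin θ) = Complex.exp (θ * Complex.I) := by
  have : (r : ℂ) ≠ 0 := by exact_mod_cast hr.ne'
  rw [phase, rad_polar hr.le, Complex.exp_mul_I]
  push_cast
  field_simp

theorem lintegral_plane_eq_polar (f : ℝ × ℝ → ℝ≥0∞) :
    ∫⁻ x, f x = ∫⁻ p in Ioi (0 : ℝ) ×ˢ Ioo (-Real.pi) Real.pi,
      ENNReal.ofReal p.1 * f (p.1 * Real.cos p.2, p.1 * Real.sin p.2) := by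
  rw [← lintegral_comp_polarCoord_symm]
  simp [polarCoord]

/-- As an inequality, Tonelli needs no measurability; this suffices for the form of W, which is only
bounded from above. -/
theorem lintegral_plane_le (f : ℝ × ℝ → ℝ≥0∞) :
    ∫⁻ x, f x ≤ ∫⁻ r in Ioi (0 : ℝ), ∫⁻ θ in Ioo (-Real.pi) Real.pi,
      ENNReal.ofReal r * f (r * Real.cos θ, r * Real.sin θ) := by
  rw [lintegral_plane_eq_polar, Measure.volume_eq_prod, ← Measure.prod_restrict]
  exact lintegral_prod_le _

theorem lintegral_plane_eq {f : ℝ × ℝ → ℝ≥0∞}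
    (hf : AEMeasurable (fun p : ℝ × ℝ => ENNReal.ofReal p.1 *
      f (p.1 * Real.cos p.2, p.1 * Real.sin p.2))
      (volume.restrict (Ioi (0 : ℝ) ×ˢ Ioo (-Real.pi) Real.pi))) :
    ∫⁻ x, f x = ∫⁻ r in Ioi (0 : ℝ), ∫⁻ θ in Ioo (-Real.pi) Real.pi,
      ENNReal.ofReal r * f (r * Real.cos θ, r * Real.sin θ) := by
  rw [lintegral_plane_eq_polar]
  rw [Measure.volume_eq_prod, ← Measure.prod_restrict] at hf ⊢
  exact lintegral_prod _ hf

/-- A property that holds almost everywhere in the plane holds on almost every circle. -/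
theorem ae_polar {p : ℝ × ℝ → Prop} (hp : ∀ᵐ x, p x) :
    ∀ᵐ r ∂(volume.restrict (Ioi (0 : ℝ))), ∀ᵐ θ ∂(volume.restrict (Ioo (-Real.pi) Real.pi)),
      p (r * Real.cos θ, r * Real.sin θ) := by
  -- Tonelli for the indicator of a measurable null superset shows that it has measure zero on
  -- almost every circle; the Jacobian r is positive and can be divided out.
  obtain ⟨N, hN, hNm, hN0⟩ := exists_measurable_superset_of_null hp
  have hm : Measurable fun q : ℝ × ℝ => ENNReal.ofReal q.1 *
      N.indicator (1 : ℝ × ℝ → ℝ≥0∞) (q.1 * Real.cos q.2, q.1 * Real.sin q.2) := by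
    refine (ENNReal.measurable_ofReal.comp measurable_fst).mul
      ((measurable_one.indicator hNm).comp ?_)
    fun_prop
  have h0 := lintegral_plane_eq (f := N.indicator 1) hm.aemeasurable
  rw [lintegral_indicator_one hNm, hN0, eq_comm, lintegral_eq_zero_iff] at h0
  · filter_upwards [h0, ae_restrict_mem measurableSet_Ioi] with r hr hr0
    simp only [Pi.zero_apply] at hr
    have hr := (lintegral_eq_zero_iff (hm.comp (measurable_prodMk_left (x := r)))).1 hr
    filter_upwards [hr] with θ hθ
    have h1 : ENNReal.ofReal r ≠ 0 := by simpa using hr0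
    have h2 : (r * Real.cos θ, r * Real.sin θ) ∉ N := by
      intro hmem
      simp [indicator_of_mem hmem] at hθ
      exact absurd hθ (not_le.2 hr0)
    by_contra h
    exact h2 (hN h)
  · exact (hm.lintegral_prod_right' (ν := volume.restrict (Ioo (-Real.pi) Real.pi)))

theorem integral_exp_int (n : ℤ) :
    ∫ θ in (-Real.pi)..Real.pi, Complex.exp (n * (θ * Complex.I)) =
      if n = 0 then (2 * Real.pi : ℂ) else 0 := by
  split_ifs with h
  · subst h
    simp; ring
  · have hn : (n : ℂ) * Complex.I ≠ 0 := mul_ne_zero (by exact_mod_cast h) Complex.I_ne_zero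
    have e : ∀ θ : ℝ, (n : ℂ) * (θ * Complex.I) = (n * Complex.I) * θ := fun θ => by ring
    simp_rw [e]
    rw [integral_exp_mul_complex hn]
    have : Complex.exp (n * Complex.I * (Real.pi : ℝ)) =
        Complex.exp (n * Complex.I * ((-Real.pi : ℝ) : ℂ)) := by
      rw [Complex.exp_eq_exp_iff_exists_int]
      exact ⟨n, by push_cast; ring⟩
    rw [this, sub_self, zero_div]

/-- Parseval's identity for trigonometric polynomials. -/
theorem lintegral_trig_sq (s : Finset ℤ) (a : ℤ → ℂ) :
    ∫⁻ θ in Ioo (-Real.pi) Real.pi, ‖∑ j ∈ s, a j * Complex.exp (θ * Complex.I) ^ j‖ₑ ^ 2 =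
      ENNReal.ofReal (2 * Real.pi) * ∑ j ∈ s, ‖a j‖ₑ ^ 2 := by
  have hc : Continuous fun θ : ℝ => ∑ j ∈ s, a j * Complex.exp (θ * Complex.I) ^ j := by
    refine continuous_finsetSum _ fun j _ => continuous_const.mul ?_
    refine Continuous.zpow₀ (by fun_prop) j fun θ => Or.inl (Complex.exp_ne_zero _)
  have key : ∫ θ in (-Real.pi)..Real.pi, ‖∑ j ∈ s, a j * Complex.exp (θ * Complex.I) ^ j‖ ^ 2 =
      2 * Real.pi * ∑ j ∈ s, ‖a j‖ ^ 2 := by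
    have h1 : ∀ θ : ℝ, ((‖∑ j ∈ s, a j * Complex.exp (θ * Complex.I) ^ j‖ ^ 2 : ℝ) : ℂ) =
        ∑ j ∈ s, ∑ k ∈ s, a j * starRingEnd ℂ (a k) *
          Complex.exp (((j - k : ℤ) : ℂ) * (θ * Complex.I)) := by
      intro θ
      push_cast
      rw [← Complex.mul_conj', map_sum, Finset.sum_mul_sum]
      refine Finset.sum_congr rfl fun j _ => Finset.sum_congr rfl fun k _ => ?_
      rw [map_mul, map_zpow₀, ← Complex.exp_conj, map_mul, Complex.conj_I, Complex.conj_ofReal,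
        ← Complex.exp_int_mul, ← Complex.exp_int_mul]
      rw [mul_mul_mul_comm, ← Complex.exp_add]
      congr 2
      ring
    have h2 : ((∫ θ in (-Real.pi)..Real.pi,
        ‖∑ j ∈ s, a j * Complex.exp (θ * Complex.I) ^ j‖ ^ 2 : ℝ) : ℂ) =
        ((2 * Real.pi * ∑ j ∈ s, ‖a j‖ ^ 2 : ℝ) : ℂ) := by
      rw [← intervalIntegral.integral_ofReal]
      simp_rw [h1]
      rw [intervalIntegral.integral_finsetSum]
      · push_cast
        rw [Finset.mul_sum]
        refine Finset.sum_congr rfl fun j hj => ?_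
        rw [intervalIntegral.integral_finsetSum]
        · simp_rw [intervalIntegral.integral_const_mul]
          simp_rw [← Int.cast_sub, integral_exp_int, sub_eq_zero]
          rw [Finset.sum_eq_single j]
          · rw [if_pos rfl, Complex.mul_conj']; ring
          · intro k _ hk
            rw [if_neg (Ne.symm hk), mul_zero]
          · exact fun h => absurd hj h
        · exact fun k _ => Continuous.intervalIntegrable (by fun_prop) _ _
      · exact fun j _ => Continuous.intervalIntegrable (by fun_prop) _ _
    exact_mod_cast h2
  have hpi : -Real.pi ≤ Real.pi := by linarith [Real.pi_pos]
  have h3 : ∀ θ : ℝ, ‖∑ j ∈ s, a j * Complex.exp (θ * Complex.I) ^ j‖ₑ ^ 2 =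
      ENNReal.ofReal (‖∑ j ∈ s, a j * Complex.exp (θ * Complex.I) ^ j‖ ^ 2) := fun θ => by
    rw [ENNReal.ofReal_pow (norm_nonneg _), ofReal_norm]
  simp_rw [h3]
  rw [← ofReal_integral_eq_lintegral_ofReal
    (μ := volume.restrict (Ioo (-Real.pi) Real.pi)) ?_ (.of_forall fun θ => by positivity)]
  · rw [restrict_Ioo_eq_restrict_Ioc, ← intervalIntegral.integral_of_le hpi, key,
      ENNReal.ofReal_mul (by positivity), ENNReal.ofReal_sum_of_nonneg (fun _ _ => by positivity)]
    congr 1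
    refine Finset.sum_congr rfl fun j _ => ?_
    rw [ENNReal.ofReal_pow (norm_nonneg _), ofReal_norm]
  · have : IntegrableOn (fun θ : ℝ => ‖∑ j ∈ s, a j * Complex.exp (θ * Complex.I) ^ j‖ ^ 2)
        (Icc (-Real.pi) Real.pi) := ((hc.norm.pow 2).continuousOn).integrableOn_Icc
    exact this.mono_set Ioo_subset_Icc_self

/-! ## The angular momentum decomposition of the forms -/

theorem spinor_enorm_sq (ψ : Spinor) : ‖ψ‖ₑ ^ 2 = ‖ψ 0‖ₑ ^ 2 + ‖ψ 1‖ₑ ^ 2 := by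
  have h := EuclideanSpace.norm_sq_eq ψ
  rw [Fin.sum_univ_two] at h
  rw [← ofReal_norm, ← ofReal_norm, ← ofReal_norm, ← ENNReal.ofReal_pow (norm_nonneg _),
    ← ENNReal.ofReal_pow (norm_nonneg _), ← ENNReal.ofReal_pow (norm_nonneg _),
    ← ENNReal.ofReal_add (by positivity) (by positivity), ← h]

/-- The normalization `(2π)^{-1/2}` of the angular Fourier coefficients. -/
def angNorm : ℂ := (((Real.sqrt (2 * Real.pi))⁻¹ : ℝ) : ℂ)

theorem enorm_angNorm_sq : ‖angNorm‖ₑ ^ 2 * ENNReal.ofReal (2 * Real.pi) = 1 := by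
  have hp : 0 < 2 * Real.pi := by positivity
  rw [← ofReal_norm, ← ENNReal.ofReal_pow (norm_nonneg _), ← ENNReal.ofReal_mul (by positivity)]
  rw [angNorm, Complex.norm_real, Real.norm_eq_abs, sq_abs, inv_pow, Real.sq_sqrt hp.le,
    inv_mul_cancel₀ hp.ne', ENNReal.ofReal_one]

theorem Core.exists_finset {φ : ℤ → ℝ → Spinor} (hφ : Core φ) :
    ∃ s : Finset ℤ, ∀ j, j ∉ s → φ j = 0 := by
  obtain ⟨N, hN⟩ := hφ.cutoff
  refine ⟨Finset.Icc (-N : ℤ) N, fun j hj => hN j ?_⟩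
  rw [Finset.mem_Icc, ← abs_le] at hj
  exact not_le.1 hj

theorem toPlane_eq_sum {φ : ℤ → ℝ → Spinor} {s : Finset ℤ} (hs : ∀ j, j ∉ s → φ j = 0)
    (x : ℝ × ℝ) : toPlane φ x = angNorm • ∑ j ∈ s, !₂[φ j (rad x) 0 * phase x ^ j,
      -Complex.I * φ j (rad x) 1 * phase x ^ (j + 1)] := by
  rw [toPlane, tsum_eq_sum (s := s)]
  · rfl
  · intro j hj
    ext i
    fin_cases i <;> simp [hs j hj]

theorem toPlane_zero {φ : ℤ → ℝ → Spinor} {s : Finset ℤ} (hs : ∀ j, j ∉ s → φ j = 0)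
    (x : ℝ × ℝ) : toPlane φ x 0 = angNorm * ∑ j ∈ s, φ j (rad x) 0 * phase x ^ j := by
  rw [toPlane_eq_sum hs]; simp

theorem toPlane_one {φ : ℤ → ℝ → Spinor} {s : Finset ℤ} (hs : ∀ j, j ∉ s → φ j = 0)
    (x : ℝ × ℝ) : toPlane φ x 1 =
      angNorm * ∑ j ∈ s, -Complex.I * φ j (rad x) 1 * phase x ^ (j + 1) := by
  rw [toPlane_eq_sum hs]; simp

theorem lintegral_angular (s : Finset ℤ) (a b : ℤ → ℂ) :
    ∫⁻ θ in Ioo (-Real.pi) Real.pi,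
      (‖angNorm * ∑ j ∈ s, a j * Complex.exp (θ * Complex.I) ^ j‖ₑ ^ 2 +
        ‖angNorm * ∑ j ∈ s, b j * Complex.exp (θ * Complex.I) ^ j‖ₑ ^ 2) =
      ∑ j ∈ s, (‖a j‖ₑ ^ 2 + ‖b j‖ₑ ^ 2) := by
  have hc : ∀ a : ℤ → ℂ, Continuous fun θ : ℝ =>
      ∑ j ∈ s, a j * Complex.exp (θ * Complex.I) ^ j := fun a => by
    refine continuous_finsetSum _ fun j _ => continuous_const.mul ?_
    refine Continuous.zpow₀ (by fun_prop) j fun θ => Or.inl (Complex.exp_ne_zero _)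
  have hm : ∀ a : ℤ → ℂ, Measurable fun θ : ℝ =>
      ‖∑ j ∈ s, a j * Complex.exp (θ * Complex.I) ^ j‖ₑ ^ 2 := fun a =>
    ((hc a).measurable.enorm).pow_const 2
  simp_rw [enorm_mul, mul_pow, ← mul_add]
  rw [lintegral_const_mul' _ _ (by simp), lintegral_add_left (hm a), lintegral_trig_sq,
    lintegral_trig_sq, ← mul_add, ← mul_assoc, enorm_angNorm_sq, one_mul, Finset.sum_add_distrib]

/-- The lower component carries e^{i(j+1)θ}. The common factor e^{iθ} has modulus one, so both
components become trigonometric sums with the same exponents. -/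
theorem toPlane_polar_enorm_sq {φ : ℤ → ℝ → Spinor} {s : Finset ℤ} (hs : ∀ j, j ∉ s → φ j = 0)
    {r : ℝ} (hr : 0 < r) (θ : ℝ) :
    ‖toPlane φ (r * Real.cos θ, r * Real.sin θ)‖ₑ ^ 2 =
      ‖angNorm * ∑ j ∈ s, φ j r 0 * Complex.exp (θ * Complex.I) ^ j‖ₑ ^ 2 +
        ‖angNorm * ∑ j ∈ s, -Complex.I * φ j r 1 * Complex.exp (θ * Complex.I) ^ j‖ₑ ^ 2 := by
  rw [spinor_enorm_sq, toPlane_zero hs, toPlane_one hs, rad_polar hr.le, phase_polar hr]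
  congr 2
  have : ∑ j ∈ s, -Complex.I * φ j r 1 * Complex.exp (θ * Complex.I) ^ (j + 1) =
      (∑ j ∈ s, -Complex.I * φ j r 1 * Complex.exp (θ * Complex.I) ^ j) *
        Complex.exp (θ * Complex.I) := by
    rw [Finset.sum_mul]
    refine Finset.sum_congr rfl fun j _ => ?_
    rw [zpow_add_one₀ (Complex.exp_ne_zero _), ← mul_assoc]
  rw [this, ← mul_assoc, enorm_mul (_ * _), ← ofReal_norm (Complex.exp _),
    Complex.norm_exp_ofReal_mul_I, ENNReal.ofReal_one, mul_one]

theorem lintegral_toPlane {φ : ℤ → ℝ → Spinor} {s : Finset ℤ} (hs : ∀ j, j ∉ s → φ j = 0)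
    {r : ℝ} (hr : 0 < r) :
    ∫⁻ θ in Ioo (-Real.pi) Real.pi, ‖toPlane φ (r * Real.cos θ, r * Real.sin θ)‖ₑ ^ 2 =
      ∑ j ∈ s, ‖φ j r‖ₑ ^ 2 := by
  simp_rw [toPlane_polar_enorm_sq hs hr]
  rw [lintegral_angular]
  refine Finset.sum_congr rfl fun j _ => ?_
  rw [spinor_enorm_sq (φ j r), enorm_mul, enorm_neg, ← ofReal_norm Complex.I, Complex.norm_I,
    ENNReal.ofReal_one, one_mul]

/-! ### The Dirac operator in polar coordinates -/

theorem hasFDerivAt_rad {x : ℝ × ℝ} (hx : 0 < rad x) :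
    HasFDerivAt rad ((x.1 / rad x) • ContinuousLinearMap.fst ℝ ℝ ℝ +
      (x.2 / rad x) • ContinuousLinearMap.snd ℝ ℝ ℝ) x := by
  have h1 : HasFDerivAt (fun y : ℝ × ℝ => y.1 ^ 2 + y.2 ^ 2)
      ((2 * x.1) • ContinuousLinearMap.fst ℝ ℝ ℝ + (2 * x.2) • ContinuousLinearMap.snd ℝ ℝ ℝ) x := by
    have := ((hasFDerivAt_fst (𝕜 := ℝ) (p := x)).pow 2).add
      ((hasFDerivAt_snd (𝕜 := ℝ) (p := x)).pow 2)
    exact this.congr_fderiv (by simp)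
  have h0 : x.1 ^ 2 + x.2 ^ 2 ≠ 0 := (Real.sqrt_pos.1 hx).ne'
  refine (h1.sqrt h0).congr_fderiv ?_
  change (1 / (2 * rad x)) • _ = _
  have := hx.ne'
  rw [smul_add, smul_smul, smul_smul]
  congr 2 <;> field_simp

theorem hasFDerivAt_phase {x : ℝ × ℝ} (hx : 0 < rad x) :
    ∃ L : ℝ × ℝ →L[ℝ] ℂ, HasFDerivAt phase L x ∧ ∀ v, L v =
      ((v.1 : ℂ) + v.2 * Complex.I) / rad x -
        phase x * (((x.1 * v.1 + x.2 * v.2 : ℝ) : ℂ) / (rad x) ^ 2) := by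
  have hr : (rad x : ℂ) ≠ 0 := by exact_mod_cast hx.ne'
  have h1 : HasFDerivAt (fun y : ℝ × ℝ => (y.1 : ℂ) + (y.2 : ℂ) * Complex.I)
      (Complex.ofRealCLM.comp (ContinuousLinearMap.fst ℝ ℝ ℝ) +
        Complex.I • Complex.ofRealCLM.comp (ContinuousLinearMap.snd ℝ ℝ ℝ)) x := by
    refine HasFDerivAt.congr_of_eventuallyEq (ContinuousLinearMap.hasFDerivAt _)
      (Eventually.of_forall fun y => ?_)
    simp [mul_comm]
  have h2 := (hasDerivAt_inv hr).comp_hasFDerivAt x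
    (Complex.ofRealCLM.hasFDerivAt.comp x (hasFDerivAt_rad hx))
  refine ⟨_, h1.mul h2, fun v => ?_⟩
  simp [phase]
  field_simp
  ring

theorem hasFDerivAt_mode {f : ℝ → ℂ} {f' : ℂ} {x : ℝ × ℝ} (hx : 0 < rad x)
    (hf : HasDerivAt f f' (rad x)) (m : ℤ) :
    ∃ L : ℝ × ℝ →L[ℝ] ℂ, HasFDerivAt (fun y => f (rad y) * phase y ^ m) L x ∧ ∀ v, L v =
      f' * (((x.1 * v.1 + x.2 * v.2 : ℝ) : ℂ) / rad x) * phase x ^ m +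
      f (rad x) * (m * phase x ^ (m - 1) * (((v.1 : ℂ) + v.2 * Complex.I) / rad x -
        phase x * (((x.1 * v.1 + x.2 * v.2 : ℝ) : ℂ) / (rad x) ^ 2))) := by
  obtain ⟨L, hL, hLv⟩ := hasFDerivAt_phase hx
  have hp : phase x ≠ 0 := by
    have h1 : (rad x : ℂ) ≠ 0 := by exact_mod_cast hx.ne'
    refine div_ne_zero (fun h => ?_) h1
    have h2 := Complex.ext_iff.1 h
    simp at h2
    simp [rad, h2] at hx
  have h1 := (hasDerivAt_zpow m (phase x) (Or.inl hp)).comp_hasFDerivAt x hL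
  have h2 := hf.hasFDerivAt.comp x (hasFDerivAt_rad hx)
  refine ⟨_, h2.mul h1, fun v => ?_⟩
  simp [hLv]
  ring

/-- In polar coordinates ∂₁ ∓ i∂₂ = e^{∓iθ}(∂_r ∓ (i/r)∂_θ), so these combinations shift the angular
momentum by one. This is the origin of the pairing of j with j + 1. -/
theorem fderiv_mode {f : ℝ → ℂ} {f' : ℂ} {r : ℝ} (hr : 0 < r) (θ : ℝ)
    (hf : HasDerivAt f f' r) (m : ℤ) :
    ∃ L : ℝ × ℝ →L[ℝ] ℂ, HasFDerivAt (fun y => f (rad y) * phase y ^ m) L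
        (r * Real.cos θ, r * Real.sin θ) ∧
      L (1, 0) - Complex.I * L (0, 1) =
        Complex.exp (θ * Complex.I) ^ (m - 1) * (f' + m / r * f r) ∧
      L (1, 0) + Complex.I * L (0, 1) =
        Complex.exp (θ * Complex.I) ^ (m + 1) * (f' - m / r * f r) := by
  have hrad := rad_polar hr.le θ
  obtain ⟨L, hL, hLv⟩ := hasFDerivAt_mode (f := f) (f' := f')
    (x := (r * Real.cos θ, r * Real.sin θ)) (by rwa [hrad]) (by rwa [hrad]) m
  refine ⟨L, hL, ?_⟩
  have hr' : (r : ℂ) ≠ 0 := by exact_mod_cast hr.ne'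
  have he := Complex.exp_ne_zero (θ * Complex.I)
  rw [hLv, hLv, hrad, phase_polar hr]
  have e1 : Complex.exp (θ * Complex.I) ^ m =
      Complex.exp (θ * Complex.I) ^ (m - 1) * Complex.exp (θ * Complex.I) := by
    rw [← zpow_add_one₀ he, sub_add_cancel]
  have e2 : Complex.exp (θ * Complex.I) ^ (m + 1) =
      Complex.exp (θ * Complex.I) ^ (m - 1) * Complex.exp (θ * Complex.I) ^ 2 := by
    rw [zpow_add_one₀ he, e1]; ring
  rw [e2, e1]
  have e3 : Complex.exp (θ * Complex.I) = Real.cos θ + Real.sin θ * Complex.I := by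
    rw [Complex.exp_mul_I]; simp
  have e4 : Complex.exp (θ * Complex.I) * (Real.cos θ - Real.sin θ * Complex.I) = 1 := by
    have h : (Real.sin θ : ℂ) ^ 2 + (Real.cos θ : ℂ) ^ 2 = 1 := by
      exact_mod_cast Real.sin_sq_add_cos_sq θ
    rw [e3]
    linear_combination h - (Real.sin θ : ℂ) ^ 2 * Complex.I_sq
  push_cast at e3 e4
  generalize Complex.exp (θ * Complex.I) ^ (m - 1) = E at *
  generalize Complex.exp (θ * Complex.I) = e at *
  have hI := Complex.I_sq
  constructor
  · push_cast
    field_simp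
    linear_combination (E * (f' * r - f r * m)) * e4 - E * f r * m * hI
  · push_cast
    field_simp
    linear_combination (E * (f' * r * e - f r * m * e)) * (-e3) + E * f r * m * hI

/-- Both Pauli matrices are off-diagonal, so each component of H₀ψ sees only the other component of
ψ, through ∂₁ − i∂₂ here and ∂₁ + i∂₂ in `dirac_one`. -/
theorem dirac_zero {α : ℝ} {ψ : ℝ × ℝ → Spinor} {x : ℝ × ℝ} {L : ℝ × ℝ →L[ℝ] ℂ}
    (hψ : DifferentiableAt ℝ ψ x) (hL : HasFDerivAt (fun y => ψ y 1) L x) :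
    dirac α ψ x 0 = -Complex.I * (L (1, 0) - Complex.I * L (0, 1)) -
      (vecA1 α x - Complex.I * vecA2 α x) * ψ x 1 := by
  have h : ∀ v, fderiv ℝ ψ x v 1 = L v := fun v => by
    have := (PiLp.proj (𝕜 := ℝ) 2 (fun _ : Fin 2 => ℂ) 1).hasFDerivAt.comp x hψ.hasFDerivAt
    exact congrArg (fun M : ℝ × ℝ →L[ℝ] ℂ => M v) (this.unique hL)
  simp [dirac, act, pauli1, pauli2, Matrix.mulVec, dotProduct,
    Fin.sum_univ_two, h]
  ring

theorem dirac_one {α : ℝ} {ψ : ℝ × ℝ → Spinor} {x : ℝ × ℝ} {L : ℝ × ℝ →L[ℝ] ℂ}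
    (hψ : DifferentiableAt ℝ ψ x) (hL : HasFDerivAt (fun y => ψ y 0) L x) :
    dirac α ψ x 1 = -Complex.I * (L (1, 0) + Complex.I * L (0, 1)) -
      (vecA1 α x + Complex.I * vecA2 α x) * ψ x 0 := by
  have h : ∀ v, fderiv ℝ ψ x v 0 = L v := fun v => by
    have := (PiLp.proj (𝕜 := ℝ) 2 (fun _ : Fin 2 => ℂ) 0).hasFDerivAt.comp x hψ.hasFDerivAt
    exact congrArg (fun M : ℝ × ℝ →L[ℝ] ℂ => M v) (this.unique hL)
  simp [dirac, act, pauli1, pauli2, Matrix.mulVec, dotProduct,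
    Fin.sum_univ_two, h]
  ring

/-- A₁ ∓ iA₂ carries the same phase e^{∓iθ} as ∂₁ ∓ i∂₂; hence the potential merges with the
derivative in a single mode. -/
theorem vecA_polar (α : ℝ) {r : ℝ} (hr : 0 < r) (θ : ℝ) :
    ((vecA1 α (r * Real.cos θ, r * Real.sin θ) : ℂ) -
      Complex.I * vecA2 α (r * Real.cos θ, r * Real.sin θ) =
        -Complex.I * potA α r * (Complex.exp (θ * Complex.I))⁻¹) ∧
    ((vecA1 α (r * Real.cos θ, r * Real.sin θ) : ℂ) +
      Complex.I * vecA2 α (r * Real.cos θ, r * Real.sin θ) =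
        Complex.I * potA α r * Complex.exp (θ * Complex.I)) := by
  have hr' : (r : ℂ) ≠ 0 := by exact_mod_cast hr.ne'
  have e3 : Complex.exp (θ * Complex.I) = Complex.cos θ + Complex.sin θ * Complex.I :=
    Complex.exp_mul_I _
  have e4 : (Complex.exp (θ * Complex.I))⁻¹ = Complex.cos θ - Complex.sin θ * Complex.I := by
    rw [← Complex.exp_neg, ← neg_mul, Complex.exp_mul_I, Complex.cos_neg, Complex.sin_neg]
    ring
  rw [e4, e3]
  simp only [vecA1, vecA2, rad_polar hr.le]
  push_cast
  have hI := Complex.I_sq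
  constructor
  · field_simp
    linear_combination -((potA α r : ℂ) * Complex.sin θ) * hI
  · field_simp
    linear_combination -((potA α r : ℂ) * Complex.sin θ) * hI

/-- The spinor `(g₁, g₂)` of first order radial operators applied to the components of `φ_j`. -/
def radDirac (α : ℝ) (φ : ℤ → ℝ → Spinor) (j : ℤ) (r : ℝ) : Spinor :=
  !₂[radOp α 1 j (fun x => φ j x 0) r, radOp α (-1) (j + 1) (fun x => φ j x 1) r]

theorem toPlane_differentiableAt {φ : ℤ → ℝ → Spinor} (hφ : Core φ) {s : Finset ℤ}
    (hs : ∀ j, j ∉ s → φ j = 0) {r : ℝ} (hr : 0 < r) (θ : ℝ) :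
    DifferentiableAt ℝ (toPlane φ) (r * Real.cos θ, r * Real.sin θ) := by
  rw [differentiableAt_piLp]
  intro i
  have h : ∀ (i : Fin 2) (j m : ℤ), DifferentiableAt ℝ (fun y => φ j (rad y) i * phase y ^ m)
      (r * Real.cos θ, r * Real.sin θ) := fun i j m => by
    obtain ⟨L, hL, -⟩ := fderiv_mode hr θ ((hφ.radial j).hasDerivAt_apply i hr) m
    exact hL.differentiableAt
  fin_cases i
  · simp only [Fin.zero_eta, toPlane_zero hs]
    exact (DifferentiableAt.fun_sum fun j _ => h 0 j j).const_mul _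
  · simp only [Fin.mk_one, toPlane_one hs, mul_assoc]
    exact (DifferentiableAt.fun_sum fun j _ => (h 1 j (j + 1)).const_mul _).const_mul _

theorem dirac_toPlane_polar {α : ℝ} {φ : ℤ → ℝ → Spinor} (hφ : Core φ) {s : Finset ℤ}
    (hs : ∀ j, j ∉ s → φ j = 0) {r : ℝ} (hr : 0 < r) (θ : ℝ) :
    dirac α (toPlane φ) (r * Real.cos θ, r * Real.sin θ) 0 =
      angNorm * ∑ j ∈ s, -radDirac α φ j r 1 * Complex.exp (θ * Complex.I) ^ j ∧
    dirac α (toPlane φ) (r * Real.cos θ, r * Real.sin θ) 1 =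
      (angNorm * ∑ j ∈ s, -Complex.I * radDirac α φ j r 0 * Complex.exp (θ * Complex.I) ^ j) *
        Complex.exp (θ * Complex.I) := by
  have hd := toPlane_differentiableAt hφ hs hr θ
  have he := Complex.exp_ne_zero (θ * Complex.I)
  have hI := Complex.I_sq
  constructor
  · choose L hL hL1 hL2 using fun j : ℤ =>
      fderiv_mode hr θ ((hφ.radial j).hasDerivAt_apply 1 hr) (j + 1)
    have hD : HasFDerivAt (fun y => toPlane φ y 1)
        (angNorm • ∑ j ∈ s, (-Complex.I) • L j) (r * Real.cos θ, r * Real.sin θ) := by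
      simp only [toPlane_one hs, mul_assoc]
      exact (HasFDerivAt.fun_sum fun j _ => (hL j).const_mul _).const_mul _
    rw [dirac_zero hd hD, (vecA_polar α hr θ).1, toPlane_one hs, rad_polar hr.le, phase_polar hr]
    simp only [smul_apply, sum_apply, smul_eq_mul,
      Finset.mul_sum, ← Finset.sum_sub_distrib]
    refine Finset.sum_congr rfl fun j _ => ?_
    have h1 := hL1 j
    rw [add_sub_cancel_right] at h1
    have h2 : radDirac α φ j r 1 = deriv (φ j) r 1 + ((j + 1 : ℤ) : ℂ) / r * φ j r 1 -
        potA α r * φ j r 1 := by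
      simp only [radDirac, radOp, ((hφ.radial j).hasDerivAt_apply 1 hr).deriv]
      simp
      ring
    rw [h2, zpow_add_one₀ he]
    have h3 : Complex.exp (θ * Complex.I) ^ j * Complex.exp (θ * Complex.I) *
      (Complex.exp (θ * Complex.I))⁻¹ = Complex.exp (θ * Complex.I) ^ j := by field_simp
    linear_combination (angNorm * Complex.I ^ 2) * h1 +
      (angNorm * Complex.exp (θ * Complex.I) ^ j * (deriv (φ j) r 1 +
        ((j + 1 : ℤ) : ℂ) / r * φ j r 1)) * hI -
      (angNorm * Complex.I ^ 2 * potA α r * φ j r 1) * h3 -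
      (angNorm * potA α r * φ j r 1 * Complex.exp (θ * Complex.I) ^ j) * hI
  · choose L hL hL1 hL2 using fun j : ℤ =>
      fderiv_mode hr θ ((hφ.radial j).hasDerivAt_apply 0 hr) j
    have hD : HasFDerivAt (fun y => toPlane φ y 0)
        (angNorm • ∑ j ∈ s, L j) (r * Real.cos θ, r * Real.sin θ) := by
      simp only [toPlane_zero hs]
      exact (HasFDerivAt.fun_sum fun j _ => hL j).const_mul _
    rw [dirac_one hd hD, (vecA_polar α hr θ).2, toPlane_zero hs, rad_polar hr.le, phase_polar hr]
    simp only [smul_apply, sum_apply, smul_eq_mul,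
      Finset.mul_sum, Finset.sum_mul, ← Finset.sum_sub_distrib, ← Finset.sum_add_distrib]
    refine Finset.sum_congr rfl fun j _ => ?_
    have h1 := hL2 j
    have h2 : radDirac α φ j r 0 = deriv (φ j) r 0 - (j : ℂ) / r * φ j r 0 +
        potA α r * φ j r 0 := by
      simp only [radDirac, radOp, ((hφ.radial j).hasDerivAt_apply 0 hr).deriv]
      simp
      ring
    rw [zpow_add_one₀ he] at h1
    rw [h2]
    linear_combination (-Complex.I * angNorm) * h1

theorem Core.continuousOn_radDirac {α : ℝ} (hα : 0 < α) {φ : ℤ → ℝ → Spinor} (hφ : Core φ) (j : ℤ)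
    (i : Fin 2) : ContinuousOn (fun r => radDirac α φ j r i) (Ioi 0) := by
  fin_cases i
  · exact ((hφ.radial j).scalar 0).continuousOn_radOp hα
  · exact ((hφ.radial j).scalar 1).continuousOn_radOp hα

/-- The quadratic form of `H₀²` in the angular momentum decomposition. -/
theorem formDiracSq_eq {α : ℝ} (hα : 0 < α) {φ : ℤ → ℝ → Spinor} (hφ : Core φ) {s : Finset ℤ}
    (hs : ∀ j, j ∉ s → φ j = 0) :
    formDiracSq α φ = ∑ j ∈ s, ∫⁻ r in Ioi (0 : ℝ), ‖radDirac α φ j r‖ₑ ^ 2 * ENNReal.ofReal r := by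
  have hpt : ∀ r : ℝ, 0 < r → ∀ θ : ℝ,
      ‖dirac α (toPlane φ) (r * Real.cos θ, r * Real.sin θ)‖ₑ ^ 2 =
      ‖angNorm * ∑ j ∈ s, -radDirac α φ j r 1 * Complex.exp (θ * Complex.I) ^ j‖ₑ ^ 2 +
      ‖angNorm * ∑ j ∈ s, -Complex.I * radDirac α φ j r 0 *
        Complex.exp (θ * Complex.I) ^ j‖ₑ ^ 2 := by
    intro r hr θ
    obtain ⟨h0, h1⟩ := dirac_toPlane_polar (α := α) hφ hs hr θ
    rw [spinor_enorm_sq, h0, h1, enorm_mul (_ * _), ← ofReal_norm (Complex.exp _),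
      Complex.norm_exp_ofReal_mul_I, ENNReal.ofReal_one, mul_one]
  have hpr : ∀ i, ContinuousOn (fun p : ℝ × ℝ => angNorm * ∑ j ∈ s,
      (-Complex.I * radDirac α φ j p.1 i) * Complex.exp (p.2 * Complex.I) ^ j)
      (Ioi (0 : ℝ) ×ˢ Ioo (-Real.pi) Real.pi) := fun i => by
    refine continuousOn_const.mul (continuousOn_finsetSum _ fun j _ => ?_)
    refine (continuousOn_const.mul ((hφ.continuousOn_radDirac hα j i).comp continuousOn_fst
      fun p hp => hp.1)).mul (Continuous.continuousOn ?_)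
    exact Continuous.zpow₀ (by fun_prop) j fun p => Or.inl (Complex.exp_ne_zero _)
  have hpr' : ∀ i, ContinuousOn (fun p : ℝ × ℝ => angNorm * ∑ j ∈ s,
      (-radDirac α φ j p.1 i) * Complex.exp (p.2 * Complex.I) ^ j)
      (Ioi (0 : ℝ) ×ˢ Ioo (-Real.pi) Real.pi) := fun i => by
    refine continuousOn_const.mul (continuousOn_finsetSum _ fun j _ => ?_)
    refine (((hφ.continuousOn_radDirac hα j i).comp continuousOn_fst
      fun p hp => hp.1).neg).mul (Continuous.continuousOn ?_)
    exact Continuous.zpow₀ (by fun_prop) j fun p => Or.inl (Complex.exp_ne_zero _)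
  have hms : MeasurableSet (Ioi (0 : ℝ) ×ˢ Ioo (-Real.pi) Real.pi) :=
    measurableSet_Ioi.prod measurableSet_Ioo
  rw [formDiracSq, lintegral_plane_eq]
  · rw [← lintegral_finsetSum']
    · refine setLIntegral_congr_fun measurableSet_Ioi fun r hr => ?_
      rw [lintegral_const_mul' _ _ ENNReal.ofReal_ne_top]
      simp_rw [hpt r hr]
      rw [lintegral_angular, Finset.mul_sum]
      refine Finset.sum_congr rfl fun j _ => ?_
      rw [spinor_enorm_sq, enorm_neg, enorm_mul, enorm_neg, ← ofReal_norm Complex.I,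
        Complex.norm_I, ENNReal.ofReal_one, one_mul, mul_comm, add_comm]
    · intro j _
      simp_rw [spinor_enorm_sq]
      have h := fun i => ((hφ.continuousOn_radDirac hα j i).aemeasurable
        (μ := volume) measurableSet_Ioi).enorm.pow_const 2
      exact ((h 0).add (h 1)).mul ENNReal.measurable_ofReal.aemeasurable
  · refine (((((hpr' 1).aemeasurable hms).enorm.pow_const 2).add
      (((hpr 0).aemeasurable hms).enorm.pow_const 2)).const_mul 1 |>.mul
      (ENNReal.measurable_ofReal.comp measurable_fst).aemeasurable).congr ?_
    refine (ae_restrict_mem hms).mono fun p hp => ?_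
    simp [hpt p.1 hp.1, mul_comm]

/-! ## Bounds for fixed angular momentum -/

theorem lintegral_energy {α s m : ℝ} (hα : 0 < α) {f : ℝ → ℂ} (hf : ScalarCore f) {η K : ℝ}
    (hη : 0 ≤ η) (hK : 0 ≤ K) :
    ∫⁻ r in Ioi (0 : ℝ), ENNReal.ofReal (r * (η * ‖radOp α s m f r‖ ^ 2 + K * ‖f r‖ ^ 2)) =
      ENNReal.ofReal η * (∫⁻ r in Ioi (0 : ℝ), ‖radOp α s m f r‖ₑ ^ 2 * ENNReal.ofReal r) +
      ENNReal.ofReal K * ∫⁻ r in Ioi (0 : ℝ), ‖f r‖ₑ ^ 2 * ENNReal.ofReal r := by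
  have h1 : AEMeasurable (fun r => ‖radOp α s m f r‖ₑ ^ 2 * ENNReal.ofReal r)
      (volume.restrict (Ioi 0)) := (((hf.continuousOn_radOp (s := s) (m := m) hα).aemeasurable
    (μ := volume) measurableSet_Ioi).enorm.pow_const 2).mul ENNReal.measurable_ofReal.aemeasurable
  rw [← lintegral_const_mul' _ _ ENNReal.ofReal_ne_top,
    ← lintegral_const_mul' _ _ ENNReal.ofReal_ne_top, ← lintegral_add_left' (h1.const_mul _)]
  refine setLIntegral_congr_fun measurableSet_Ioi fun r hr => ?_
  have hr0 : 0 ≤ r := le_of_lt hr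
  rw [← ofReal_norm, ← ofReal_norm, ← ENNReal.ofReal_pow (norm_nonneg _),
    ← ENNReal.ofReal_pow (norm_nonneg _), ← ENNReal.ofReal_mul (by positivity),
    ← ENNReal.ofReal_mul (by positivity), ← ENNReal.ofReal_mul (by positivity),
    ← ENNReal.ofReal_mul (by positivity), ← ENNReal.ofReal_add (by positivity) (by positivity)]
  congr 1
  ring

/-- The quadratic form of `H₀²` in the channel `j`. -/
def channelDirac (α : ℝ) (φ : ℤ → ℝ → Spinor) (j : ℤ) : ℝ≥0∞ :=
  ∫⁻ r in Ioi (0 : ℝ), ‖radDirac α φ j r‖ₑ ^ 2 * ENNReal.ofReal r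

/-- The squared norm of the channel `j`. -/
def channelNorm (φ : ℤ → ℝ → Spinor) (j : ℤ) : ℝ≥0∞ :=
  ∫⁻ r in Ioi (0 : ℝ), ‖φ j r‖ₑ ^ 2 * ENNReal.ofReal r

theorem channelDirac_eq {α : ℝ} (hα : 0 < α) {φ : ℤ → ℝ → Spinor} (hφ : Core φ) (j : ℤ) :
    channelDirac α φ j =
      (∫⁻ r in Ioi (0 : ℝ), ‖radOp α 1 j (fun x => φ j x 0) r‖ₑ ^ 2 * ENNReal.ofReal r) +
      ∫⁻ r in Ioi (0 : ℝ), ‖radOp α (-1) (j + 1) (fun x => φ j x 1) r‖ₑ ^ 2 *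
        ENNReal.ofReal r := by
  have h1 : AEMeasurable (fun r => ‖radOp α 1 j (fun x => φ j x 0) r‖ₑ ^ 2 * ENNReal.ofReal r)
      (volume.restrict (Ioi 0)) :=
    (((((hφ.radial j).scalar 0).continuousOn_radOp (s := 1) (m := j) hα).aemeasurable (μ := volume)
      measurableSet_Ioi).enorm.pow_const 2).mul ENNReal.measurable_ofReal.aemeasurable
  rw [← lintegral_add_left' h1]
  simp only [channelDirac, spinor_enorm_sq, add_mul]
  rfl

theorem Core.measurable_weight {φ : ℤ → ℝ → Spinor} (hφ : Core φ) (j : ℤ) (i : Fin 2) :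
    AEMeasurable (fun r => ‖φ j r i‖ₑ ^ 2 * ENNReal.ofReal r) (volume.restrict (Ioi 0)) :=
  (((((hφ.radial j).scalar i).continuousOn.mono Ioi_subset_Ici_self).aemeasurable
    (μ := volume) measurableSet_Ioi).enorm.pow_const 2).mul ENNReal.measurable_ofReal.aemeasurable

theorem Core.measurable_density {φ : ℤ → ℝ → Spinor} (hφ : Core φ) (j : ℤ) :
    AEMeasurable (fun r => ‖φ j r‖ₑ ^ 2 * ENNReal.ofReal r) (volume.restrict (Ioi 0)) := by
  simp only [spinor_enorm_sq, add_mul]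
  exact (hφ.measurable_weight j 0).add (hφ.measurable_weight j 1)

theorem channelNorm_eq {φ : ℤ → ℝ → Spinor} (hφ : Core φ) (j : ℤ) :
    channelNorm φ j = (∫⁻ r in Ioi (0 : ℝ), ‖φ j r 0‖ₑ ^ 2 * ENNReal.ofReal r) +
      ∫⁻ r in Ioi (0 : ℝ), ‖φ j r 1‖ₑ ^ 2 * ENNReal.ofReal r := by
  rw [← lintegral_add_left' (hφ.measurable_weight j 0)]
  simp only [channelNorm, spinor_enorm_sq, add_mul]

/-- A locally square integrable weight is form bounded on bounded intervals with arbitrarily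
small relative bound, uniformly in the angular momentum. -/
theorem exists_local_form_bound {α : ℝ} (hα : 0 < α) {R : ℝ} (hR : 0 < R) {w : ℝ → ℝ}
    (hw : MemLp w 2 (volume.restrict (Icc 0 R))) {κ : ℝ} (hκ : 0 < κ) :
    ∃ C : ℝ, 0 ≤ C ∧ ∀ φ : ℤ → ℝ → Spinor, Core φ → ∀ j : ℤ,
      ∫⁻ r in Ioc 0 R, ENNReal.ofReal (w r ^ 2) * ‖φ j r‖ₑ ^ 2 * ENNReal.ofReal r ≤
        ENNReal.ofReal κ * channelDirac α φ j + ENNReal.ofReal C * channelNorm φ j := by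
  set I := ∫⁻ r in Ioc 0 R, ENNReal.ofReal (w r ^ 2) with hI
  have hwm : AEMeasurable (fun r => ENNReal.ofReal (w r ^ 2)) (volume.restrict (Ioc 0 R)) :=
    ((hw.1.aemeasurable.mono_measure (Measure.restrict_mono Ioc_subset_Icc_self le_rfl)).pow_const
      2).ennreal_ofReal
  have hIfin : I ≠ ⊤ := by
    have h1 : Integrable (fun r => w r ^ 2) (volume.restrict (Ioc 0 R)) :=
      (hw.integrable_sq).mono_measure (Measure.restrict_mono Ioc_subset_Icc_self le_rfl)
    rw [hI, ← ofReal_integral_eq_lintegral_ofReal h1 (.of_forall fun _ => sq_nonneg _)]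
    exact ENNReal.ofReal_ne_top
  have hI1 : 0 < I.toReal + 1 := by positivity
  -- The integral of w² r|φ_j|² is at most I times the sup of r|φ_j|², and I · κ/(I + 1) ≤ κ; the
  -- summand 1 covers I = 0. The weight r of the measure is used up by the sup bound, so w need only
  -- be in L²(dr).
  obtain ⟨C, hC, hCb⟩ := exists_local_sup_bound hα hR (η := κ / (I.toReal + 1)) (by positivity)
  refine ⟨I.toReal * C, by positivity, fun φ hφ j => ?_⟩
  have hb : ∀ r ∈ Ioc 0 R, ‖φ j r‖ₑ ^ 2 * ENNReal.ofReal r ≤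
      ENNReal.ofReal (κ / (I.toReal + 1)) * channelDirac α φ j +
        ENNReal.ofReal C * channelNorm φ j := by
    intro r hr
    have h0 := hCb 1 j (by norm_num) _ ((hφ.radial j).scalar 0) r hr
    have h1 := hCb (-1) (j + 1) (by norm_num) _ ((hφ.radial j).scalar 1) r hr
    rw [lintegral_energy hα ((hφ.radial j).scalar _) (by positivity) hC] at h0 h1
    rw [channelDirac_eq hα hφ, channelNorm_eq hφ, spinor_enorm_sq, add_mul]
    have e : ∀ i, ‖φ j r i‖ₑ ^ 2 * ENNReal.ofReal r = ENNReal.ofReal (r * ‖φ j r i‖ ^ 2) := by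
      intro i
      rw [mul_comm, ENNReal.ofReal_mul hr.1.le, ENNReal.ofReal_pow (norm_nonneg _), ofReal_norm]
    rw [e, e]
    refine (add_le_add h0 h1).trans (le_of_eq ?_)
    ring
  calc ∫⁻ r in Ioc 0 R, ENNReal.ofReal (w r ^ 2) * ‖φ j r‖ₑ ^ 2 * ENNReal.ofReal r
      ≤ ∫⁻ r in Ioc 0 R, ENNReal.ofReal (w r ^ 2) *
        (ENNReal.ofReal (κ / (I.toReal + 1)) * channelDirac α φ j +
        ENNReal.ofReal C * channelNorm φ j) := by
        refine setLIntegral_mono' measurableSet_Ioc fun r hr => ?_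
        rw [mul_assoc]
        gcongr
        exact hb r hr
    _ = I * (ENNReal.ofReal (κ / (I.toReal + 1)) * channelDirac α φ j +
        ENNReal.ofReal C * channelNorm φ j) := lintegral_mul_const'' _ hwm
    _ ≤ _ := by
        rw [mul_add, ← mul_assoc, ← mul_assoc]
        have e : I = ENNReal.ofReal I.toReal := (ENNReal.ofReal_toReal hIfin).symm
        gcongr
        · nth_rewrite 1 [e]
          rw [← ENNReal.ofReal_mul (by positivity)]
          refine ENNReal.ofReal_le_ofReal ?_
          rw [mul_div_assoc', div_le_iff₀ hI1]
          nlinarith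
        · nth_rewrite 1 [e]
          rw [← ENNReal.ofReal_mul (by positivity)]

/-! ### The auxiliary angle and the bound on A² -/

theorem one_le_bracket (x : ℝ) : 1 ≤ bracket x := by
  rw [bracket, Real.one_le_sqrt]
  nlinarith [sq_nonneg x]

theorem abs_le_bracket (x : ℝ) : |x| ≤ bracket x :=
  Real.abs_le_sqrt (by linarith)

theorem bracket_le {x : ℝ} (hx : 2 ≤ |x|) : bracket x ≤ 3 / 2 * |x| := by
  rw [bracket, Real.sqrt_le_left (by positivity), mul_pow, sq_abs]
  nlinarith [sq_abs x]

/-- The angle `t` of an auxiliary partition of unity `(sin t)² + (cos t)² = 1` subordinate to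
`χ_j`: the effective potential dominates `μ A²` where `sin t ≠ 0`, and `λ_j χ_j`
dominates `A` where `cos t ≠ 0`. -/
theorem exists_angle {α Cs μ δ j0 c cμ δμc : ℝ} (hα : 0 < α) (hμ : μ ∈ Ioo (0 : ℝ) 1)
    (hδ : δ ∈ Ioo (0 : ℝ) 1) (hj0 : 1 < j0) (hc : 1 < c)
    (hcμ : IsCMu α μ cμ) (hccμ : cμ ≤ c) (hδμ : IsDeltaMu α μ c δμc) (hδδμ : δ ≤ δμc)
    {χ : ℤ → ℝ → ℝ} (hχ : IsPartition α Cs δ c j0 χ) :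
    ∃ K : ℝ, 0 ≤ K ∧ ∀ j : ℤ, ∃ t t' : ℝ → ℝ, (∀ r, HasDerivAt t (t' r) r) ∧
      (∀ r, |t' r| ≤ K) ∧
      (∀ r, 0 < r → Real.sin (t r) ≠ 0 → EffGe α j r (μ * potA α r ^ 2)) ∧
      (∀ r, 0 < r → potA α r ^ 2 * Real.cos (t r) ^ 2 ≤ (lam α c j * χ j r) ^ 2) := by
  obtain ⟨K, hK, hKb⟩ := exists_abs_deriv_smoothTransition_le
  obtain ⟨g, hg, hχg⟩ := hχ
  have hδ0 := hδ.1
  have hc0 : 0 < c := by linarith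
  have hσ0 : 0 < sig α := by rw [sig]; positivity
  have hσ1 : sig α ≤ 1 := by rw [sig, div_le_one (by positivity)]; linarith
  have hSd : ∀ (p w r : ℝ), HasDerivAt (fun r => Real.smoothTransition ((r - p) / w))
      (deriv Real.smoothTransition ((r - p) / w) * (1 / w)) r := fun p w r =>
    (hasDerivAt_smoothTransition _).comp r (((hasDerivAt_id r).sub_const p).div_const w)
  have hSb : ∀ x w B : ℝ, 0 < w → 1 / w ≤ B →
      |deriv Real.smoothTransition x * (1 / w)| ≤ K * B := fun x w B hw hB => by
    rw [abs_mul, abs_of_pos (by positivity : 0 < 1 / w)]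
    exact mul_le_mul (hKb x) hB (by positivity) hK
  have hpi : |Real.pi / 2| ≤ 2 := by
    rw [abs_of_pos (by positivity)]; linarith [Real.pi_lt_four]
  have hcos : ∀ (j : ℤ) (r : ℝ), 0 < r → r ≤ 2 * c * bracket j ^ sig α → χ j r = 1 →
      ∀ t : ℝ, potA α r ^ 2 * Real.cos t ^ 2 ≤ (lam α c j * χ j r) ^ 2 := by
    intro j r hr hrL h1 t
    rw [h1, mul_one]
    have h2 := potA_mono hα hr.le hrL
    have h3 := potA_nonneg α hr.le
    calc potA α r ^ 2 * Real.cos t ^ 2 ≤ potA α r ^ 2 * 1 := by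
          gcongr; exact Real.cos_sq_le_one t
      _ ≤ lam α c j ^ 2 := by rw [mul_one]; exact pow_le_pow_left₀ h3 h2 2
  have hδinv : 0 < 2 / δ := by positivity
  -- The outer 2 bounds π/2. The inner layer has width at least δ/2 and the outer one at least 1/2,
  -- for every j.
  refine ⟨2 * (K * (2 / δ) + K * 2), by positivity, fun j => ?_⟩
  set L := bracket j ^ sig α with hLdef
  have hL1 : 1 ≤ L := Real.one_le_rpow (one_le_bracket _) hσ0.le
  have hcL : 1 ≤ c * L := by nlinarith
  have hout : ∀ r, c * L ≤ r → EffGe α j r (μ * potA α r ^ 2) :=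
    fun r hr => hcμ.2 c hccμ j r hr
  rcases le_or_gt |(j : ℝ)| j0 with hj | hj
  -- For small |j| there is no inner cutoff: t is 0 up to c⟨j⟩^σ and reaches π/2 at 2c⟨j⟩^σ, before
  -- which χ_j = 1.
  · refine ⟨fun r => Real.pi / 2 * Real.smoothTransition ((r - c * L) / (c * L)), _,
      fun r => (hSd (c * L) (c * L) r).const_mul _, fun r => ?_, fun r hr hsin => ?_,
      fun r hr => ?_⟩
    · rw [abs_mul]
      refine mul_le_mul hpi ?_ (abs_nonneg _) (by norm_num)
      have h1 := hSb ((r - c * L) / (c * L)) (c * L) 2 (by linarith)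
        ((div_le_one (by linarith)).2 hcL |>.trans (by norm_num))
      have : 0 ≤ K * (2 / δ) := by positivity
      linarith
    · refine hout r ?_
      by_contra h
      refine hsin ?_
      beta_reduce
      rw [Real.smoothTransition.zero_of_nonpos, mul_zero, Real.sin_zero]
      exact div_nonpos_of_nonpos_of_nonneg (by linarith) (by linarith)
    · rcases lt_or_ge r (2 * c * L) with h | h
      · refine hcos j r hr h.le ?_ _
        rw [hχg j r hr, if_pos hj, hCut, if_pos]
        rw [div_lt_iff₀ (by linarith)]
        exact h
      · beta_reduce
        rw [Real.smoothTransition.one_of_one_le, mul_one, Real.cos_pi_div_two]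
        · simp only [ne_eq, OfNat.ofNat_ne_zero, not_false_eq_true, zero_pow, mul_zero]
          positivity
        · rw [one_le_div (by linarith)]
          linarith
  · have hj2 : 2 ≤ |j| := by
      have h1 : (1 : ℝ) < ((|j| : ℤ) : ℝ) := by push_cast; linarith
      have h2 : 1 < |j| := by exact_mod_cast h1
      omega
    have hj2' : (2 : ℝ) ≤ |(j : ℝ)| := by exact_mod_cast hj2
    set M := |(j : ℝ)| ^ sig α with hMdef
    have hM1 : 1 ≤ M := Real.one_le_rpow (by linarith) hσ0.le
    have hML : M ≤ L := Real.rpow_le_rpow (abs_nonneg _) (abs_le_bracket _) hσ0.le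
    have hLM : L ≤ 3 / 2 * M := by
      calc L ≤ (3 / 2 * |(j : ℝ)|) ^ sig α :=
            Real.rpow_le_rpow (by linarith [one_le_bracket j]) (bracket_le hj2') hσ0.le
        _ = (3 / 2) ^ sig α * M := Real.mul_rpow (by norm_num) (abs_nonneg _)
        _ ≤ (3 / 2) ^ (1 : ℝ) * M := by
            gcongr
            norm_num
        _ = _ := by rw [Real.rpow_one]
    set p := δ * M / 2 with hp
    have hp0 : δ / 2 ≤ p := by rw [hp]; nlinarith
    have hpp : 0 < p := by linarith
    -- The outer layer must end at 2c|j|^σ, where χ_j may leave the value 1, but can only start at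
    -- c⟨j⟩^σ. The bound L ≤ (3/2)M leaves a width of at least cM/2.
    set w := 2 * c * M - c * L with hwdef
    have hw2 : 1 / 2 ≤ w := by rw [hwdef]; nlinarith
    have hδM : δ * M ≤ M := by nlinarith [hδ.2]
    have hMcM : M ≤ c * M := by nlinarith
    have hcML : c * M ≤ c * L := by gcongr
    -- The angle falls from π/2 to 0 on [δM/2, δM], inside the inner region where V_j is large, and
    -- climbs back to π/2 on [cL, 2cM]. The two layers are disjoint since δM ≤ M ≤ cL.
    refine ⟨fun r => Real.pi / 2 * (1 - Real.smoothTransition ((r - p) / p) +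
      Real.smoothTransition ((r - c * L) / w)), _,
      fun r => (((hSd p p r).const_sub 1).add (hSd (c * L) w r)).const_mul _,
      fun r => ?_, fun r hr hsin => ?_, fun r hr => ?_⟩
    · rw [abs_mul]
      refine mul_le_mul hpi ((abs_add_le _ _).trans (add_le_add ?_ ?_)) (abs_nonneg _) (by norm_num)
      · rw [abs_neg]
        refine hSb _ p _ hpp ?_
        rw [div_le_div_iff₀ hpp hδ0]
        linarith
      · refine hSb _ w _ (by linarith) ?_
        rw [div_le_iff₀ (by linarith)]
        linarith
    · rcases le_or_gt (c * L) r with h | h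
      · exact hout r h
      have h2 : r ≤ δ * M := by
        by_contra h2
        refine hsin ?_
        beta_reduce
        rw [Real.smoothTransition.zero_of_nonpos (x := (r - c * L) / w),
          Real.smoothTransition.one_of_one_le]
        · simp
        · rw [one_le_div hpp, hp]; linarith
        · exact div_nonpos_of_nonpos_of_nonneg (by linarith) (by linarith)
      have h3 := hδμ.2.2 δ hδ0 hδδμ j hj2 r hr h2
      have h4 : μ * potA α r ^ 2 ≤ μ * potA α (2 * c * M) ^ 2 := by
        have := potA_mono hα hr.le (show r ≤ 2 * c * M by linarith)
        have := potA_nonneg α hr.le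
        have := hμ.1.le
        gcongr
      exact ⟨h4.trans h3.1, h4.trans h3.2⟩
    · have hvanish : ∀ x : ℝ, x = 1 → potA α r ^ 2 * Real.cos (Real.pi / 2 * x) ^ 2 ≤
          (lam α c j * χ j r) ^ 2 := fun x hx => by
        rw [hx, mul_one, Real.cos_pi_div_two]
        simp only [ne_eq, OfNat.ofNat_ne_zero, not_false_eq_true, zero_pow, mul_zero]
        positivity
      rcases le_or_gt r p with h | h
      · refine hvanish _ ?_
        rw [Real.smoothTransition.zero_of_nonpos, Real.smoothTransition.zero_of_nonpos]
        · ring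
        · exact div_nonpos_of_nonpos_of_nonneg (by linarith) (by linarith)
        · exact div_nonpos_of_nonpos_of_nonneg (by linarith) (by linarith)
      rcases lt_or_ge r (2 * c * M) with h' | h'
      · refine hcos j r hr (h'.le.trans (by rw [mul_assoc, mul_assoc]; linarith)) ?_ _
        rw [hχg j r hr, if_neg (not_le.2 hj)]
        refine hg.one_mid _ ⟨?_, ?_⟩
        · rw [lt_div_iff₀ (by linarith)]
          linarith
        · rw [div_lt_iff₀ (by linarith)]
          exact h'
      · refine hvanish _ ?_
        rw [Real.smoothTransition.one_of_one_le, Real.smoothTransition.one_of_one_le]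
        · ring
        · rw [one_le_div (by linarith)]; linarith
        · rw [one_le_div hpp]; linarith

/-- The form of multiplication by `m²` in the channel `j`. -/
def channelMul (m : ℝ → ℝ) (φ : ℤ → ℝ → Spinor) (j : ℤ) : ℝ≥0∞ :=
  ∫⁻ r in Ioi (0 : ℝ), ENNReal.ofReal (m r ^ 2) * ‖φ j r‖ₑ ^ 2 * ENNReal.ofReal r

theorem Core.measurable_potA {α : ℝ} (hα : 0 < α) {φ : ℤ → ℝ → Spinor} (hφ : Core φ) (j : ℤ) :
    AEMeasurable (fun r => ENNReal.ofReal (potA α r ^ 2) * ‖φ j r‖ₑ ^ 2 * ENNReal.ofReal r)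
      (volume.restrict (Ioi 0)) := by
  simp only [mul_assoc]
  exact (((continuous_potA hα).pow 2).measurable.ennreal_ofReal.aemeasurable).mul
    (hφ.measurable_density j)

/-- `A² ≤ μ⁻¹ H₀² + χ λ² χ + C` in each channel, with `C` independent of the channel. -/
theorem exists_potential_form_bound {α Cs μ δ j0 c cμ δμc : ℝ} (hα : 0 < α) (hμ : μ ∈ Ioo (0 : ℝ) 1)
    (hδ : δ ∈ Ioo (0 : ℝ) 1) (hj0 : 1 < j0) (hc : 1 < c)
    (hcμ : IsCMu α μ cμ) (hccμ : cμ ≤ c) (hδμ : IsDeltaMu α μ c δμc) (hδδμ : δ ≤ δμc)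
    {χ : ℤ → ℝ → ℝ} (hχ : IsPartition α Cs δ c j0 χ) :
    ∃ C : ℝ, 0 ≤ C ∧ ∀ φ : ℤ → ℝ → Spinor, Core φ → ∀ j : ℤ,
      channelMul (potA α) φ j ≤ ENNReal.ofReal (1 / μ) * channelDirac α φ j +
        channelMul (fun r => lam α c j * χ j r) φ j + ENNReal.ofReal C * channelNorm φ j := by
  obtain ⟨K, hK, hKt⟩ := exists_angle hα hμ hδ hj0 hc hcμ hccμ hδμ hδδμ hχ
  have hμ0 := hμ.1
  -- The localization error K², divided by μ along with the Dirac energy.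
  refine ⟨1 / μ * K ^ 2, by positivity, fun φ hφ j => ?_⟩
  obtain ⟨t, t', ht, htK, hsin, hcos⟩ := hKt j
  have htc : Continuous t := continuous_iff_continuousAt.2 fun r => (ht r).continuousAt
  have hA := continuous_potA hα
  set u : ℝ → ℝ≥0∞ := fun r => ENNReal.ofReal (μ * potA α r ^ 2 * Real.sin (t r) ^ 2) with hu
  have hum : Measurable u := by
    refine (Continuous.measurable ?_).ennreal_ofReal
    fun_prop
  have hcomp : ∀ i : Fin 2, ∀ s m : ℝ, s ^ 2 = 1 →
      (∀ r, 0 < r → Real.sin (t r) ≠ 0 →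
        μ * potA α r ^ 2 ≤ (m / r - potA α r) ^ 2 - s * fieldB α r) →
      ∫⁻ r in Ioi (0 : ℝ), u r * (‖φ j r i‖ₑ ^ 2 * ENNReal.ofReal r) ≤
        (∫⁻ r in Ioi (0 : ℝ), ‖radOp α s m (fun x => φ j x i) r‖ₑ ^ 2 * ENNReal.ofReal r) +
        ENNReal.ofReal (K ^ 2) * ∫⁻ r in Ioi (0 : ℝ), ‖φ j r i‖ₑ ^ 2 * ENNReal.ofReal r := by
    intro i s m hs hV
    have h := ((hφ.radial j).scalar i).eff_le hα hs hμ0.le ht htK hV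
    rw [lintegral_energy hα ((hφ.radial j).scalar i) zero_le_one (sq_nonneg K),
      ENNReal.ofReal_one, one_mul] at h
    refine le_trans (le_of_eq (setLIntegral_congr_fun measurableSet_Ioi fun r hr => ?_)) h
    have hr0 : 0 ≤ r := le_of_lt hr
    simp only [hu]
    rw [← ofReal_norm, ← ENNReal.ofReal_pow (norm_nonneg _), ← ENNReal.ofReal_mul (by positivity),
      ← ENNReal.ofReal_mul (by positivity), ← mul_assoc]
  have h0 := hcomp 0 1 j (by norm_num) fun r hr h => by
    simpa [effMinus] using (hsin r hr h).2
  have h1 := hcomp 1 (-1) (j + 1) (by norm_num) fun r hr h => by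
    simpa [effPlus] using (hsin r hr h).1
  have hU : ∫⁻ r in Ioi (0 : ℝ), u r * (‖φ j r‖ₑ ^ 2 * ENNReal.ofReal r) ≤
      channelDirac α φ j + ENNReal.ofReal (K ^ 2) * channelNorm φ j := by
    simp_rw [spinor_enorm_sq, add_mul, mul_add]
    have hm : AEMeasurable (fun r => u r * (‖φ j r 0‖ₑ ^ 2 * ENNReal.ofReal r))
      (volume.restrict (Ioi 0)) := hum.aemeasurable.mul (hφ.measurable_weight j 0)
    rw [lintegral_add_left' hm,
      channelDirac_eq hα hφ, channelNorm_eq hφ]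
    refine (add_le_add h0 h1).trans (le_of_eq ?_)
    ring
  calc channelMul (potA α) φ j
      ≤ ∫⁻ r in Ioi (0 : ℝ), (ENNReal.ofReal (1 / μ) *
          (u r * (‖φ j r‖ₑ ^ 2 * ENNReal.ofReal r)) +
          ENNReal.ofReal ((lam α c j * χ j r) ^ 2) * ‖φ j r‖ₑ ^ 2 * ENNReal.ofReal r) := by
        refine setLIntegral_mono' measurableSet_Ioi fun r hr => ?_
        rw [← mul_assoc, mul_assoc, mul_assoc (ENNReal.ofReal ((lam α c j * χ j r) ^ 2)), ← add_mul]
        gcongr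
        rw [hu, ← ENNReal.ofReal_mul (by positivity),
          ← ENNReal.ofReal_add (by positivity) (by positivity)]
        refine ENNReal.ofReal_le_ofReal ?_
        have e : 1 / μ * (μ * potA α r ^ 2 * Real.sin (t r) ^ 2) =
          potA α r ^ 2 * Real.sin (t r) ^ 2 := by field_simp
        rw [e]
        have := hcos r hr
        have h2 := Real.sin_sq_add_cos_sq (t r)
        calc potA α r ^ 2 = potA α r ^ 2 * Real.sin (t r) ^ 2 +
              potA α r ^ 2 * Real.cos (t r) ^ 2 := by rw [← mul_add, h2, mul_one]
          _ ≤ _ := by linarith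
    _ = ENNReal.ofReal (1 / μ) * (∫⁻ r in Ioi (0 : ℝ), u r * (‖φ j r‖ₑ ^ 2 * ENNReal.ofReal r)) +
          channelMul (fun r => lam α c j * χ j r) φ j := by
        have hm : AEMeasurable (fun r => u r * (‖φ j r‖ₑ ^ 2 * ENNReal.ofReal r))
          (volume.restrict (Ioi 0)) := hum.aemeasurable.mul (hφ.measurable_density j)
        rw [lintegral_add_left' (hm.const_mul _),
          lintegral_const_mul' _ _ ENNReal.ofReal_ne_top]
        rfl
    _ ≤ ENNReal.ofReal (1 / μ) * (channelDirac α φ j + ENNReal.ofReal (K ^ 2) * channelNorm φ j) +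
          channelMul (fun r => lam α c j * χ j r) φ j := by gcongr
    _ = _ := by
        rw [mul_add, ← mul_assoc, ← ENNReal.ofReal_mul (by positivity)]
        ring

/-! ### From pointwise bounds on the weight to form bounds -/

/-- Pointwise domination of `w²` by `a A² + K` gives the corresponding form bound. -/
theorem channelMul_le_of_ae {α a K : ℝ} (hα : 0 < α) (ha : 0 ≤ a) (hK : 0 ≤ K) {w : ℝ → ℝ}
    {S : Set ℝ} (hS : S ⊆ Ioi 0)
    (hw : ∀ᵐ r ∂(volume.restrict S), w r ^ 2 ≤ a * potA α r ^ 2 + K)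
    {φ : ℤ → ℝ → Spinor} (hφ : Core φ) (j : ℤ) :
    ∫⁻ r in S, ENNReal.ofReal (w r ^ 2) * ‖φ j r‖ₑ ^ 2 * ENNReal.ofReal r ≤
      ENNReal.ofReal a * channelMul (potA α) φ j + ENNReal.ofReal K * channelNorm φ j := by
  calc ∫⁻ r in S, ENNReal.ofReal (w r ^ 2) * ‖φ j r‖ₑ ^ 2 * ENNReal.ofReal r
      ≤ ∫⁻ r in S, (ENNReal.ofReal a * (ENNReal.ofReal (potA α r ^ 2) * ‖φ j r‖ₑ ^ 2 *
          ENNReal.ofReal r) + ENNReal.ofReal K * (‖φ j r‖ₑ ^ 2 * ENNReal.ofReal r)) := by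
        refine lintegral_mono_ae (hw.mono fun r hr => ?_)
        rw [mul_assoc, mul_assoc, ← mul_assoc (ENNReal.ofReal a), ← add_mul,
          ← ENNReal.ofReal_mul ha, ← ENNReal.ofReal_add (by positivity) hK]
        gcongr
    _ ≤ ∫⁻ r in Ioi (0 : ℝ), (ENNReal.ofReal a * (ENNReal.ofReal (potA α r ^ 2) * ‖φ j r‖ₑ ^ 2 *
          ENNReal.ofReal r) + ENNReal.ofReal K * (‖φ j r‖ₑ ^ 2 * ENNReal.ofReal r)) :=
        lintegral_mono_set hS
    _ = _ := by
        rw [lintegral_add_left' ((hφ.measurable_potA hα j).const_mul _),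
          lintegral_const_mul' _ _ ENNReal.ofReal_ne_top,
          lintegral_const_mul' _ _ ENNReal.ofReal_ne_top]
        rfl

/-- On (0, R] the weight is only square integrable and is absorbed by the Dirac energy with
coefficient κ; the pointwise domination is needed only beyond R. -/
theorem exists_channelMul_bound {α a K R κ : ℝ} (hα : 0 < α) (ha : 0 ≤ a) (hK : 0 ≤ K)
    (hR : 0 < R) (hκ : 0 < κ) {w : ℝ → ℝ} (hwL : MemLp w 2 (volume.restrict (Icc 0 R)))
    (hw : ∀ r, R < r → w r ^ 2 ≤ a * potA α r ^ 2 + K) :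
    ∃ C : ℝ, 0 ≤ C ∧ ∀ φ : ℤ → ℝ → Spinor, Core φ → ∀ j : ℤ,
      channelMul w φ j ≤ ENNReal.ofReal a * channelMul (potA α) φ j +
        ENNReal.ofReal κ * channelDirac α φ j + ENNReal.ofReal C * channelNorm φ j := by
  obtain ⟨C, hC, hCb⟩ := exists_local_form_bound hα hR hwL hκ
  refine ⟨K + C, by positivity, fun φ hφ j => ?_⟩
  have h1 := channelMul_le_of_ae hα ha hK (S := Ioi R) (Ioi_subset_Ioi hR.le)
    ((ae_restrict_mem measurableSet_Ioi).mono hw) hφ j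
  have h2 := hCb φ hφ j
  rw [channelMul, ← Ioc_union_Ioi_eq_Ioi hR.le,
    lintegral_union measurableSet_Ioi (Ioc_disjoint_Ioi le_rfl)]
  refine (add_le_add h2 h1).trans (le_of_eq ?_)
  rw [ENNReal.ofReal_add hK hC]
  ring

theorem formDiagSq_eq_sum (m : ℤ → ℝ → ℝ) {φ : ℤ → ℝ → Spinor} {s : Finset ℤ}
    (hs : ∀ j, j ∉ s → φ j = 0) : formDiagSq m φ = ∑ j ∈ s, channelMul (m j) φ j := by
  refine tsum_eq_sum fun j hj => ?_
  simp [hs j hj]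

/-- Summation of the channel estimates. -/
theorem form_bound_of_channel_bounds {α a κ μ c C1 C2 : ℝ} (hα : 0 < α) (ha : 0 ≤ a) (hκ : 0 ≤ κ)
    (hμ : 0 < μ) (hC1 : 0 ≤ C1) (hC2 : 0 ≤ C2) {w : ℝ → ℝ} {χ : ℤ → ℝ → ℝ}
    {φ : ℤ → ℝ → Spinor} (hφ : Core φ)
    (h1 : ∀ j : ℤ, channelMul w φ j ≤ ENNReal.ofReal a * channelMul (potA α) φ j +
        ENNReal.ofReal (κ / μ) * channelDirac α φ j + ENNReal.ofReal C1 * channelNorm φ j)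
    (h2 : ∀ j : ℤ, channelMul (potA α) φ j ≤ ENNReal.ofReal (1 / μ) * channelDirac α φ j +
        channelMul (fun r => lam α c j * χ j r) φ j + ENNReal.ofReal C2 * channelNorm φ j) :
    formDiagSq (fun _ => w) φ ≤ ENNReal.ofReal ((a + κ) / μ) * formDiracSq α φ +
      ENNReal.ofReal a * formDiagSq (fun j r => lam α c j * χ j r) φ +
      -- The summand 1 only serves to make the final constant strictly positive.
      ENNReal.ofReal (C1 + a * C2 + 1) * formDiagSq (fun _ _ => 1) φ := by
  obtain ⟨s, hs⟩ := hφ.exists_finset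
  rw [formDiagSq_eq_sum _ hs, formDiagSq_eq_sum _ hs, formDiagSq_eq_sum _ hs,
    formDiracSq_eq hα hφ hs, Finset.mul_sum, Finset.mul_sum, Finset.mul_sum,
    ← Finset.sum_add_distrib, ← Finset.sum_add_distrib]
  refine Finset.sum_le_sum fun j _ => ?_
  have hN : channelMul (fun _ => 1) φ j = channelNorm φ j := by simp [channelMul, channelNorm]
  have hD : (∫⁻ r in Ioi (0 : ℝ), ‖radDirac α φ j r‖ₑ ^ 2 * ENNReal.ofReal r) =
    channelDirac α φ j := rfl
  rw [hN, hD]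
  calc channelMul w φ j
      ≤ ENNReal.ofReal a * (ENNReal.ofReal (1 / μ) * channelDirac α φ j +
        channelMul (fun r => lam α c j * χ j r) φ j + ENNReal.ofReal C2 * channelNorm φ j) +
        ENNReal.ofReal (κ / μ) * channelDirac α φ j + ENNReal.ofReal C1 * channelNorm φ j :=
        (h1 j).trans (by gcongr; exact h2 j)
    _ = (ENNReal.ofReal (a * (1 / μ)) + ENNReal.ofReal (κ / μ)) * channelDirac α φ j +
        ENNReal.ofReal a * channelMul (fun r => lam α c j * χ j r) φ j +
        (ENNReal.ofReal (a * C2) + ENNReal.ofReal C1) * channelNorm φ j := by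
        rw [ENNReal.ofReal_mul ha, ENNReal.ofReal_mul ha]
        ring
    _ ≤ _ := by
        rw [← ENNReal.ofReal_add (by positivity) (by positivity),
          ← ENNReal.ofReal_add (by positivity) (by positivity)]
        have e : a * (1 / μ) + κ / μ = (a + κ) / μ := by ring
        rw [e]
        exact add_le_add le_rfl (mul_le_mul' (ENNReal.ofReal_le_ofReal (by linarith)) le_rfl)

/-! ## The perturbation is dominated by `v_β` -/

/-- A square integrable function on the circle with summable Fourier coefficients is almost
everywhere the sum of its Fourier series. -/
theorem ae_hasSum_fourier {T : ℝ} [hT : Fact (0 < T)] {f : AddCircle T → ℂ}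
    (hf : MemLp f 2 AddCircle.haarAddCircle) (hs : Summable (fourierCoeff f)) :
    ∀ᵐ x ∂(AddCircle.haarAddCircle (T := T)),
      HasSum (fun n => fourierCoeff f n * fourier n x) (f x) := by
  have hcoeff : fourierCoeff (hf.toLp f) = fourierCoeff f := fourierCoeff_congr_ae hf.coeFn_toLp
  have hsum : Summable fun n => fourierCoeff f n • (fourier n : C(AddCircle T, ℂ)) := by
    refine Summable.of_norm ?_
    simp_rw [norm_smul, fourier_norm, mul_one]
    exact hs.norm
  -- The uniform limit of the Fourier series is a continuous representative of f: both have the same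
  -- L² Fourier series.
  obtain ⟨g, hg⟩ := hsum
  have h1 := hasSum_fourier_series_L2 (hf.toLp f)
  rw [hcoeff] at h1
  have h2 := hg.mapL (ContinuousMap.toLp (E := ℂ) 2 AddCircle.haarAddCircle ℂ)
  simp only [map_smul] at h2
  have h3 := h1.unique h2
  have h4 : f =ᵐ[AddCircle.haarAddCircle] g :=
    hf.coeFn_toLp.symm.trans (h3 ▸ ContinuousMap.coeFn_toLp AddCircle.haarAddCircle g)
  filter_upwards [h4] with x hx
  rw [hx]
  simpa using ContinuousMap.hasSum_apply hg x

/-- Fourier expansion of the restriction of a function to a circle. -/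
theorem ae_hasSum_angCoeff {w : ℝ × ℝ → ℂ} {r : ℝ}
    (hw : MemLp (fun θ : ℝ => w (r * Real.cos θ, r * Real.sin θ)) 2
      (volume.restrict (Ioo (-Real.pi) Real.pi)))
    (hs : Summable (angCoeff w r)) :
    ∀ᵐ θ : ℝ ∂(volume.restrict (Ioo (-Real.pi) Real.pi)),
      HasSum (fun n : ℤ => angNorm * angCoeff w r n * Complex.exp (θ * Complex.I) ^ n)
        (w (r * Real.cos θ, r * Real.sin θ)) := by
  set h : ℝ → ℂ := fun θ => w (r * Real.cos θ, r * Real.sin θ) with hh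
  have hT : Fact (0 < 2 * Real.pi) := ⟨by positivity⟩
  have hper : Function.Periodic h (2 * Real.pi) := fun θ => by simp [hh]
  set H : AddCircle (2 * Real.pi) → ℂ := hper.lift with hH
  have hHc : ∀ θ : ℝ, H θ = h θ := fun θ => hper.lift_coe θ
  have hlift : H = AddCircle.liftIoc (2 * Real.pi) (-Real.pi) h := by
    funext x
    conv_lhs => rw [← (AddCircle.equivIoc (2 * Real.pi) (-Real.pi)).symm_apply_apply x]
    exact hHc _
  have hpi : -Real.pi + 2 * Real.pi = Real.pi := by ring
  have hHL : MemLp H 2 AddCircle.haarAddCircle := by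
    rw [memLp_haarAddCircle_iff, hlift]
    refine MemLp.memLp_liftIoc ?_
    rw [hpi, ← restrict_Ioo_eq_restrict_Ioc]
    exact hw
  have hcoeff : ∀ n : ℤ, fourierCoeff H n = angNorm * angCoeff w r n := by
    intro n
    -- The symmetric normalization (2π)^{-1/2} is used here, against 1/(2π) in `fourierCoeff`; one
    -- factor stays outside as `angNorm`.
    have hsq : (angNorm * angNorm : ℂ) = 1 / (2 * Real.pi) := by
      rw [angNorm, ← Complex.ofReal_mul, ← mul_inv, Real.mul_self_sqrt (by positivity)]
      push_cast
      ring
    rw [fourierCoeff_eq_intervalIntegral H n 0, zero_add, angCoeff]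
    change _ = angNorm * (angNorm * _)
    rw [← mul_assoc, hsq, Complex.real_smul]
    push_cast
    congr 1
    refine intervalIntegral.integral_congr fun θ _ => ?_
    simp only [hHc, smul_eq_mul]
    rw [mul_comm, fourier_coe_apply]
    congr 2
    have : (Real.pi : ℂ) ≠ 0 := by exact_mod_cast Real.pi_ne_zero
    push_cast
    field_simp
  have hsum : Summable (fourierCoeff H) := by
    have : fourierCoeff H = fun n => angNorm * angCoeff w r n := funext hcoeff
    rw [this]
    exact hs.mul_left _
  have key := ae_hasSum_fourier hHL hsum
  have key2 : ∀ᵐ x ∂(volume : Measure (AddCircle (2 * Real.pi))),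
      HasSum (fun n => fourierCoeff H n * fourier n x) (H x) := by
    rw [AddCircle.volume_eq_smul_haarAddCircle]
    exact Measure.ae_smul_measure key _
  have key3 := (AddCircle.measurePreserving_mk (2 * Real.pi) (-Real.pi)).quasiMeasurePreserving.ae key2
  rw [hpi, ← restrict_Ioo_eq_restrict_Ioc] at key3
  filter_upwards [key3] with θ hθ
  have hθ' : HasSum (fun n => fourierCoeff H n * fourier n (θ : AddCircle (2 * Real.pi))) (H θ) := hθ
  rw [hHc] at hθ'
  convert hθ' using 2 with n
  rw [hcoeff, fourier_coe_apply, ← Complex.exp_int_mul]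
  congr 2
  have : (Real.pi : ℂ) ≠ 0 := by exact_mod_cast Real.pi_ne_zero
  push_cast
  field_simp

/-- A locally square integrable function is square integrable on almost every circle. -/
theorem ae_memLp_circle {w : ℝ × ℝ → ℂ}
    (hw : ∀ K : Set (ℝ × ℝ), IsCompact K → MemLp w 2 (volume.restrict K)) :
    ∀ᵐ r ∂(volume.restrict (Ioi (0 : ℝ))),
      MemLp (fun θ : ℝ => w (r * Real.cos θ, r * Real.sin θ)) 2
        (volume.restrict (Ioo (-Real.pi) Real.pi)) := by
  have key : ∀ N : ℕ, ∀ᵐ r : ℝ ∂(volume.restrict (Ioi (0 : ℝ))), r ≤ N →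
      MemLp (fun θ : ℝ => w (r * Real.cos θ, r * Real.sin θ)) 2
        (volume.restrict (Ioo (-Real.pi) Real.pi)) := by
    intro N
    set K : Set (ℝ × ℝ) := Metric.closedBall 0 N with hK
    have hKm : MeasurableSet K := Metric.isClosed_closedBall.measurableSet
    have hwK := hw K (isCompact_closedBall _ _)
    -- Tonelli requires a measurable representative; `ae_polar` carries the almost everywhere
    -- equality with w over to almost every circle. K is a sup norm ball and contains all circles of
    -- radius at most N.
    set F : ℝ × ℝ → ℂ := K.indicator (hwK.1.mk w) with hF
    have hFm : Measurable F := (hwK.1.stronglyMeasurable_mk.measurable).indicator hKm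
    have hae : ∀ᵐ x : ℝ × ℝ, x ∈ K → w x = F x := by
      filter_upwards [(ae_restrict_iff' hKm).1 hwK.1.ae_eq_mk] with x hx hxK
      rw [hx hxK, hF, indicator_of_mem hxK]
    have hfin : ∫⁻ x, ‖F x‖ₑ ^ 2 < ⊤ := by
      have h1 := (eLpNorm_lt_top_iff_lintegral_rpow_enorm_lt_top (by simp) (by simp)).1
        (hwK.ae_eq hwK.1.ae_eq_mk).2
      have h2 : ∀ x, ‖F x‖ₑ ^ 2 =
          K.indicator (fun x => ‖hwK.1.mk w x‖ₑ ^ (2 : ℝ≥0∞).toReal) x := by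
        intro x
        by_cases hx : x ∈ K <;> simp [hF, hx]
      simp_rw [h2]
      rwa [lintegral_indicator hKm]
    have hFp : Measurable fun q : ℝ × ℝ => F (q.1 * Real.cos q.2, q.1 * Real.sin q.2) :=
      hFm.comp (by fun_prop)
    have hm : Measurable fun q : ℝ × ℝ => ENNReal.ofReal q.1 *
        ‖F (q.1 * Real.cos q.2, q.1 * Real.sin q.2)‖ₑ ^ 2 :=
      (ENNReal.measurable_ofReal.comp measurable_fst).mul (hFp.enorm.pow_const 2)
    rw [lintegral_plane_eq (f := fun x => ‖F x‖ₑ ^ 2) hm.aemeasurable] at hfin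
    have hlt := ae_lt_top (hm.lintegral_prod_right' (ν := volume.restrict (Ioo (-Real.pi) Real.pi)))
      hfin.ne
    filter_upwards [hlt, ae_polar hae, ae_restrict_mem measurableSet_Ioi] with r hr1 hr2 hr0 hrN
    have hr0' : 0 < r := hr0
    have hmem : ∀ θ : ℝ, (r * Real.cos θ, r * Real.sin θ) ∈ K := by
      intro θ
      rw [hK, mem_closedBall_zero_iff, Prod.norm_def, max_le_iff]
      simp only [norm_mul, Real.norm_eq_abs, abs_of_pos hr0']
      have h1 := Real.abs_cos_le_one θ
      have h2 := Real.abs_sin_le_one θ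
      constructor <;> nlinarith
    have hFr : Measurable fun θ : ℝ => F (r * Real.cos θ, r * Real.sin θ) :=
      hFp.comp (measurable_prodMk_left (x := r))
    have hL : MemLp (fun θ : ℝ => F (r * Real.cos θ, r * Real.sin θ)) 2
        (volume.restrict (Ioo (-Real.pi) Real.pi)) := by
      refine ⟨hFr.aestronglyMeasurable,
        (eLpNorm_lt_top_iff_lintegral_rpow_enorm_lt_top (by simp) (by simp)).2 ?_⟩
      rw [lintegral_const_mul' _ _ ENNReal.ofReal_ne_top] at hr1
      have h3 := (ENNReal.mul_lt_top_iff.1 hr1)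
      have h4 : ENNReal.ofReal r ≠ 0 := by simpa using hr0'
      rcases h3 with h3 | h3 | h3
      · simpa using h3.2
      · exact absurd h3 h4
      · simp only [ENNReal.toReal_ofNat, ENNReal.rpow_ofNat]
        rw [h3]
        simp
    refine hL.ae_eq ?_
    filter_upwards [hr2] with θ hθ
    exact (hθ (hmem θ)).symm
  filter_upwards [ae_all_iff.2 key] with r hr
  obtain ⟨N, hN⟩ := exists_nat_ge r
  exact hr N hN

/-- For finite β two geometric series add up to (1 + e^{-β})/(1 − e^{-β}) = coth(β/2), and coth is
decreasing on (0, ∞). With y = e^{β/4} this reads (y⁴+1)/(y⁴−1) ≤ (y²+1)/(y²−1). -/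
theorem exists_hasSum_angDecay {β : ℝ≥0∞} (hβ : 0 < β) :
    ∃ D : ℝ, HasSum (angDecay β) D ∧ D ≤ cothQuarter β := by
  by_cases h : β = ⊤
  · refine ⟨1, ?_, by simp [cothQuarter, h]⟩
    have : angDecay β = fun j => if j = 0 then 1 else 0 := by
      funext j; simp [angDecay, h]
    rw [this]
    exact hasSum_ite_eq 0 1
  · set b := β.toReal with hb
    have hb0 : 0 < b := ENNReal.toReal_pos hβ.ne' h
    set q := Real.exp (-b) with hq
    have hq0 : 0 ≤ q := (Real.exp_pos _).le
    have hq1 : q < 1 := (Real.exp_lt_exp.2 (by linarith : -b < 0)).trans_eq Real.exp_zero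
    refine ⟨(1 - q)⁻¹ + q * (1 - q)⁻¹, ?_, ?_⟩
    · refine HasSum.of_nat_of_neg_add_one ?_ ?_
      · have : (fun n : ℕ => angDecay β n) = fun n => q ^ n := by
          funext n
          rw [angDecay, if_neg h, hq, ← Real.exp_nat_mul]
          congr 1
          simp; ring
        rw [this]
        exact hasSum_geometric_of_lt_one hq0 hq1
      · have : (fun n : ℕ => angDecay β (-(n + 1))) = fun n => q * q ^ n := by
          funext n
          rw [angDecay, if_neg h, ← pow_succ', hq, ← Real.exp_nat_mul]
          congr 1
          have : |(((-(n + 1) : ℤ)) : ℝ)| = n + 1 := by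
            push_cast
            rw [abs_neg, abs_of_pos (by positivity)]
          rw [this]
          push_cast
          ring
        rw [this]
        exact (hasSum_geometric_of_lt_one hq0 hq1).mul_left q
    · rw [cothQuarter, if_neg h]
      set y := Real.exp (b / 4) with hy
      have hy1 : 1 < y := Real.one_lt_exp_iff.2 (by positivity)
      have hy0 : 0 < y := by linarith
      have hqy : q = (y ^ 4)⁻¹ := by
        rw [hq, hy, ← Real.exp_nat_mul, ← Real.exp_neg]
        congr 1; push_cast; ring
      rw [Real.cosh_eq, Real.sinh_eq, Real.exp_neg, ← hy]
      have hy2 : 1 < y ^ 2 := by nlinarith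
      have hy4 : 1 < y ^ 4 := by nlinarith
      have e1 : (1 - q)⁻¹ + q * (1 - q)⁻¹ = (y ^ 4 + 1) / (y ^ 4 - 1) := by
        have h1 : 1 - q ≠ 0 := by linarith
        have h2 : y ^ 4 - 1 ≠ 0 := by linarith
        have h3 : y ^ 4 * q = 1 := by rw [hqy]; field_simp
        field_simp
        linear_combination (2 : ℝ) * h3
      have e2 : (y + y⁻¹) / 2 / ((y - y⁻¹) / 2) = (y ^ 2 + 1) / (y ^ 2 - 1) := by
        have h2 : y ^ 2 - 1 ≠ 0 := by linarith
        have h3 : y - y⁻¹ ≠ 0 := by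
          have : y - y⁻¹ = (y ^ 2 - 1) / y := by field_simp
          rw [this]; positivity
        rw [div_div_div_cancel_right₀ two_ne_zero, div_eq_div_iff h3 h2]
        field_simp
      rw [e1, e2, div_le_div_iff₀ (by linarith) (by linarith)]
      nlinarith [sq_nonneg y]

theorem hasSum_spinor {ι : Type*} {f : ι → Spinor} {a : Spinor}
    (h : ∀ i, HasSum (fun n => f n i) (a i)) : HasSum f a := by
  have h1 : HasSum (fun n => (f n).ofLp) a.ofLp := Pi.hasSum.2 h
  exact h1.mapL ((PiLp.continuousLinearEquiv 2 ℂ (fun _ : Fin 2 => ℂ)).symm :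
    (Fin 2 → ℂ) →L[ℂ] Spinor)

theorem norm_angNorm_le_one : ‖angNorm‖ ≤ 1 := by
  rw [angNorm, Complex.norm_real, Real.norm_eq_abs, abs_of_nonneg (by positivity)]
  refine inv_le_one_of_one_le₀ (Real.one_le_sqrt.2 ?_)
  linarith [Real.pi_gt_three]

theorem act_apply_zero (M : Matrix (Fin 2) (Fin 2) ℂ) (ψ : Spinor) :
    act M ψ 0 = M 0 0 * ψ 0 + M 0 1 * ψ 1 := by
  simp [act, Matrix.mulVec, dotProduct, Fin.sum_univ_two]

theorem act_apply_one (M : Matrix (Fin 2) (Fin 2) ℂ) (ψ : Spinor) :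
    act M ψ 1 = M 1 0 * ψ 0 + M 1 1 * ψ 1 := by
  simp [act, Matrix.mulVec, dotProduct, Fin.sum_univ_two]

theorem norm_act_le (M : Matrix (Fin 2) (Fin 2) ℂ) (ψ : Spinor) : ‖act M ψ‖ ≤ opNorm M * ‖ψ‖ :=
  ContinuousLinearMap.le_opNorm _ _

theorem norm_entry_le_opNorm (M : Matrix (Fin 2) (Fin 2) ℂ) (i k : Fin 2) :
    ‖M i k‖ ≤ opNorm M := by
  have h := norm_act_le M (EuclideanSpace.single k 1)
  rw [show ‖(EuclideanSpace.single k 1 : Spinor)‖ = 1 by simp, mul_one] at h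
  refine le_trans (le_of_eq ?_) ((PiLp.norm_apply_le _ i).trans h)
  fin_cases i
  · change _ = ‖act M _ 0‖
    rw [act_apply_zero]
    fin_cases k <;> simp
  · change _ = ‖act M _ 1‖
    rw [act_apply_one]
    fin_cases k <;> simp

/-- A bound on all angular Fourier coefficients bounds the matrix pointwise on the circle. -/
theorem norm_act_le_of_hasSum {β : ℝ≥0∞} (hβ : 0 < β) {W : ℝ × ℝ → Matrix (Fin 2) (Fin 2) ℂ}
    {v : ℝ → ℝ} {r θ : ℝ} {x : ℝ × ℝ}
    (hb : ∀ j : ℤ, opNorm (angMatrix W r j) ≤ v r * angDecay β j)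
    (hsum : ∀ i k, HasSum (fun n : ℤ => angNorm * angCoeff (fun y => W y i k) r n *
      Complex.exp (θ * Complex.I) ^ n) (W x i k)) (ψ : Spinor) :
    ‖act (W x) ψ‖ ≤ vBeta β v r * ‖ψ‖ := by
  obtain ⟨D, hD, hDc⟩ := exists_hasSum_angDecay hβ
  set e := Complex.exp (θ * Complex.I) with he
  have he0 : e ≠ 0 := Complex.exp_ne_zero _
  have he1 : ‖e‖ = 1 := Complex.norm_exp_ofReal_mul_I θ
  have hrot : ∀ φ : Spinor, ‖(!₂[φ 0, e⁻¹ * φ 1] : Spinor)‖ = ‖φ‖ := fun φ => by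
    simp [EuclideanSpace.norm_eq, Fin.sum_univ_two, he1]
  have hv0 : 0 ≤ v r := by
    have h0 := (norm_nonneg _).trans (hb 0)
    have h1 : angDecay β 0 = 1 := by simp [angDecay]
    rwa [h1, mul_one] at h0
  -- Conjugation by the unitary diag(1, e^{-iθ}) undoes the index shifts j ∓ 1 of the off-diagonal
  -- entries, so that whole matrices `angMatrix W r j` appear in the sum. Entrywise bounds would
  -- lose the operator norm.
  set ξ : Spinor := !₂[ψ 0, e⁻¹ * ψ 1] with hξ
  have key : HasSum (fun j : ℤ => (angNorm * e ^ j) • act (angMatrix W r j) ξ)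
      !₂[act (W x) ψ 0, e⁻¹ * act (W x) ψ 1] := by
    refine hasSum_spinor fun i => ?_
    fin_cases i
    · have h := ((hsum 0 0).mul_right (ψ 0)).add
        (((Equiv.subRight (1 : ℤ)).hasSum_iff.2 (hsum 0 1)).mul_right (ψ 1))
      have e1 : (!₂[act (W x) ψ 0, e⁻¹ * act (W x) ψ 1] : Spinor) 0 =
        W x 0 0 * ψ 0 + W x 0 1 * ψ 1 := by simp [act_apply_zero]
      refine (e1 ▸ h).congr_fun ?_
      intro j
      simp only [Fin.zero_eta, PiLp.smul_apply, act_apply_zero, smul_eq_mul, Function.comp,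
        Equiv.subRight_apply]
      simp [angMatrix, hξ]
      rw [zpow_sub_one₀ he0]
      ring
    · have h := (((Equiv.addRight (1 : ℤ)).hasSum_iff.2 (hsum 1 0)).mul_right (e⁻¹ * ψ 0)).add
        ((hsum 1 1).mul_right (e⁻¹ * ψ 1))
      have e1 : (!₂[act (W x) ψ 0, e⁻¹ * act (W x) ψ 1] : Spinor) 1 =
        W x 1 0 * (e⁻¹ * ψ 0) + W x 1 1 * (e⁻¹ * ψ 1) := by
          simp [act_apply_one]; ring
      refine (e1 ▸ h).congr_fun ?_
      intro j
      simp only [Fin.mk_one, PiLp.smul_apply, act_apply_one, smul_eq_mul, Function.comp,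
        Equiv.coe_addRight]
      simp [angMatrix, hξ]
      rw [zpow_add_one₀ he0]
      field_simp
  have hbound := key.norm_le_of_bounded (hD.mul_left (v r * ‖ψ‖)) fun j => ?_
  · rw [hrot] at hbound
    refine hbound.trans ?_
    rw [vBeta]
    have := mul_le_mul_of_nonneg_right hDc (mul_nonneg hv0 (norm_nonneg ψ))
    linarith
  · rw [norm_smul, norm_mul, norm_zpow, he1, one_zpow, mul_one]
    have h1 := norm_act_le (angMatrix W r j) ξ
    rw [hξ, hrot, ← hξ] at h1
    have h2 := mul_le_mul_of_nonneg_right (hb j) (norm_nonneg ψ)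
    calc ‖angNorm‖ * ‖act (angMatrix W r j) ξ‖ ≤ 1 * ‖act (angMatrix W r j) ξ‖ := by
          gcongr; exact norm_angNorm_le_one
      _ ≤ _ := by rw [one_mul]; linarith

theorem Perturbation.ae_norm_act_le {α : ℝ} {β : ℝ≥0∞} {μs : ℝ} {v : ℝ → ℝ}
    {W : ℝ × ℝ → Matrix (Fin 2) (Fin 2) ℂ} (hW : Perturbation α β μs v W) :
    ∀ᵐ r : ℝ ∂(volume.restrict (Ioi (0 : ℝ))),
      ∀ᵐ θ : ℝ ∂(volume.restrict (Ioo (-Real.pi) Real.pi)), ∀ ψ : Spinor,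
        ‖act (W (r * Real.cos θ, r * Real.sin θ)) ψ‖ ≤ vBeta β v r * ‖ψ‖ := by
  have hL : ∀ i k, ∀ᵐ r : ℝ ∂(volume.restrict (Ioi (0 : ℝ))),
      MemLp (fun θ : ℝ => W (r * Real.cos θ, r * Real.sin θ) i k) 2
        (volume.restrict (Ioo (-Real.pi) Real.pi)) := fun i k =>
    ae_memLp_circle fun K hK => hW.locSq_W K hK i k
  filter_upwards [hW.smooth_angle, hL 0 0, hL 0 1, hL 1 0, hL 1 1] with r hb h00 h01 h10 h11
  obtain ⟨D, hD, -⟩ := exists_hasSum_angDecay hW.β_pos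
  have hS := (hD.summable.mul_left (v r))
  have hentry : ∀ i k j, ‖angMatrix W r j i k‖ ≤ v r * angDecay β j := fun i k j =>
    (norm_entry_le_opNorm _ i k).trans (hb j)
  have s00 : Summable (angCoeff (fun y => W y 0 0) r) :=
    Summable.of_norm_bounded hS fun j => hentry 0 0 j
  have s11 : Summable (angCoeff (fun y => W y 1 1) r) :=
    Summable.of_norm_bounded hS fun j => hentry 1 1 j
  -- The off-diagonal coefficients are bounded with a shifted index, and summability over ℤ is
  -- invariant under the shift.
  have s01 : Summable (angCoeff (fun y => W y 0 1) r) := by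
    refine (Equiv.subRight (1 : ℤ)).summable_iff.1 (Summable.of_norm_bounded hS fun j => ?_)
    exact hentry 0 1 j
  have s10 : Summable (angCoeff (fun y => W y 1 0) r) := by
    refine (Equiv.addRight (1 : ℤ)).summable_iff.1 (Summable.of_norm_bounded hS fun j => ?_)
    exact hentry 1 0 j
  filter_upwards [ae_hasSum_angCoeff h00 s00, ae_hasSum_angCoeff h01 s01,
    ae_hasSum_angCoeff h10 s10, ae_hasSum_angCoeff h11 s11] with θ t00 t01 t10 t11 ψ
  refine norm_act_le_of_hasSum (θ := θ) hW.β_pos hb (fun i k => ?_) ψ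
  fin_cases i <;> fin_cases k
  exacts [t00, t01, t10, t11]

theorem Perturbation.aemeasurable_vBeta {α : ℝ} {β : ℝ≥0∞} {μs : ℝ} {v : ℝ → ℝ}
    {W : ℝ × ℝ → Matrix (Fin 2) (Fin 2) ℂ} (hW : Perturbation α β μs v W) :
    AEMeasurable (vBeta β v) (volume.restrict (Ioi 0)) := by
  have h : AEMeasurable v (volume.restrict (⋃ n : ℕ, Icc (0 : ℝ) n)) :=
    aemeasurable_iUnion_iff.2 fun n => (hW.locSq_v n).1.aemeasurable
  have hsub : Ioi (0 : ℝ) ⊆ ⋃ n : ℕ, Icc (0 : ℝ) n := fun r hr => by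
    obtain ⟨n, hn⟩ := exists_nat_ge r
    exact mem_iUnion.2 ⟨n, le_of_lt hr, hn⟩
  exact (h.mono_measure (Measure.restrict_mono hsub le_rfl)).const_mul _

/-- `W² ≤ v_β²` in the sense of quadratic forms. -/
theorem Perturbation.formMulSq_le {α : ℝ} {β : ℝ≥0∞} {μs : ℝ} {v : ℝ → ℝ}
    {W : ℝ × ℝ → Matrix (Fin 2) (Fin 2) ℂ} (hW : Perturbation α β μs v W)
    {φ : ℤ → ℝ → Spinor} (hφ : Core φ) :
    formMulSq W φ ≤ formDiagSq (fun _ => vBeta β v) φ := by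
  obtain ⟨s, hs⟩ := hφ.exists_finset
  rw [formDiagSq_eq_sum _ hs]
  simp only [channelMul]
  rw [← lintegral_finsetSum' _ fun j _ => ?_]
  · refine (lintegral_plane_le _).trans (lintegral_mono_ae ?_)
    filter_upwards [hW.ae_norm_act_le, ae_restrict_mem measurableSet_Ioi] with r hr hr0
    calc ∫⁻ θ in Ioo (-Real.pi) Real.pi, ENNReal.ofReal r *
          ‖act (W (r * Real.cos θ, r * Real.sin θ))
            (toPlane φ (r * Real.cos θ, r * Real.sin θ))‖ₑ ^ 2
        ≤ ∫⁻ θ in Ioo (-Real.pi) Real.pi, ENNReal.ofReal r * (ENNReal.ofReal (vBeta β v r ^ 2) *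
          ‖toPlane φ (r * Real.cos θ, r * Real.sin θ)‖ₑ ^ 2) := by
          refine lintegral_mono_ae (hr.mono fun θ hθ => ?_)
          gcongr
          have h := hθ (toPlane φ (r * Real.cos θ, r * Real.sin θ))
          rw [← ofReal_norm, ← ofReal_norm, ← ENNReal.ofReal_pow (norm_nonneg _),
            ← ENNReal.ofReal_pow (norm_nonneg _), ← ENNReal.ofReal_mul (sq_nonneg _), ← mul_pow]
          exact ENNReal.ofReal_le_ofReal (pow_le_pow_left₀ (norm_nonneg _) h 2)
      _ = _ := by
          rw [lintegral_const_mul' _ _ ENNReal.ofReal_ne_top,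
            lintegral_const_mul' _ _ ENNReal.ofReal_ne_top, lintegral_toPlane hs hr0,
            Finset.mul_sum, Finset.mul_sum]
          refine Finset.sum_congr rfl fun j _ => ?_
          ring
  · simp only [mul_assoc]
    exact ((hW.aemeasurable_vBeta.pow_const 2).ennreal_ofReal).mul (hφ.measurable_density j)

/-! ## The form inequality -/

theorem memLp_vBeta {β : ℝ≥0∞} {v : ℝ → ℝ} {R : ℝ}
    (hv : MemLp v 2 (volume.restrict (Icc 0 R))) :
    MemLp (vBeta β v) 2 (volume.restrict (Icc 0 R)) := hv.const_mul _

theorem vBeta_sq_le_of_omegaPart_le {α μs K : ℝ} {β : ℝ≥0∞} {v : ℝ → ℝ} {r : ℝ}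
    (h : omegaPart α β μs v r ≤ K) : vBeta β v r ^ 2 ≤ μs * potA α r ^ 2 + K ^ 2 := by
  have h0 : 0 ≤ omegaPart α β μs v r := Real.sqrt_nonneg _
  have h1 : omegaPart α β μs v r ^ 2 = max (vBeta β v r ^ 2 - μs * potA α r ^ 2) 0 :=
    Real.sq_sqrt (le_max_right _ _)
  have h2 := pow_le_pow_left₀ h0 h 2
  have h3 := le_max_left (vBeta β v r ^ 2 - μs * potA α r ^ 2) 0
  linarith

/-- The limsup is pointwise and not essential, so the bound holds at every large r. -/
theorem Perturbation.exists_vBeta_sq_le {α : ℝ} {β : ℝ≥0∞} {μs : ℝ} {v : ℝ → ℝ}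
    {W : ℝ × ℝ → Matrix (Fin 2) (Fin 2) ℂ} (hW : Perturbation α β μs v W) {ε : ℝ} (hε : 0 < ε) :
    ∃ R : ℝ, 0 < R ∧ ∀ r, R < r → vBeta β v r ^ 2 ≤ (μs + ε) * potA α r ^ 2 := by
  have hlim : limsup (fun r : ℝ => ENNReal.ofReal (vBeta β v r ^ 2 / potA α r ^ 2)) atTop <
      ENNReal.ofReal (μs + ε) := by
    rw [hW.control]
    have := hW.μs_nonneg
    exact (ENNReal.ofReal_lt_ofReal_iff (by linarith)).2 (by linarith)
  obtain ⟨R, hR⟩ := eventually_atTop.1 (eventually_lt_of_limsup_lt hlim)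
  refine ⟨max R 1, by positivity, fun r hr => ?_⟩
  have h1 := hR r ((le_max_left _ _).trans hr.le)
  have hr0 : 0 < r := (zero_lt_one.trans_le (le_max_right R 1)).trans hr
  have hA : 0 < potA α r := Real.rpow_pos_of_pos hr0 _
  have h2 := (ENNReal.ofReal_lt_ofReal_iff_of_nonneg (by positivity)).1 h1
  exact ((div_lt_iff₀ (by positivity)).1 h2).le

end DiracMag

end

/-! ### Assembly of the three cases -/

theorem theorem4
    (α : ℝ) (hα : 0 < α)
    (β : ℝ≥0∞) (μs : ℝ) (v : ℝ → ℝ) (W : ℝ × ℝ → Matrix (Fin 2) (Fin 2) ℂ)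
    (hW : DiracMag.Perturbation α β μs v W)
    (Cs μ δ ε0 j0 c cμ δμc : ℝ)
    (hCs : 2 < Cs)
    (hμ : μ ∈ Ioo (0 : ℝ) 1) (hμs : μs < μ)
    (hδ : δ ∈ Ioo (0 : ℝ) 1) (hε0 : ε0 ∈ Ioo (0 : ℝ) 1) (hj0 : 1 < j0) (hc : 1 < c)
    (hcμ : DiracMag.IsCMu α μ cμ) (hccμ : cμ ≤ c)
    (hδμ : DiracMag.IsDeltaMu α μ c δμc) (hδδμ : δ ≤ δμc)
    (herr : Cs * max (1 / c) (1 / (δ * j0 ^ DiracMag.sig α)) ≤ ε0)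
    (χ : ℤ → ℝ → ℝ) (hχ : DiracMag.IsPartition α Cs δ c j0 χ) :
    (∀ εs ∈ Ioo (0 : ℝ) 1, ∀ ε1 ∈ Ioo (0 : ℝ) 1, ∃ C0 : ℝ, 0 < C0 ∧
      DiracMag.FormBound α β μs μ c v W χ ε1 εs C0) ∧
    ((∃ K : ℝ, ∀ᵐ r ∂(volume.restrict (Ioi (0 : ℝ))), DiracMag.omegaPart α β μs v r ≤ K) →
      ∃ C0 : ℝ, 0 < C0 ∧ DiracMag.FormBound α β μs μ c v W χ 0 0 C0) ∧
    (limsup (fun r : ℝ => ENNReal.ofReal |DiracMag.omegaPart α β μs v r|) atTop = 0 →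
      ∀ ε1 ∈ Ioo (0 : ℝ) 1, ∃ C0 : ℝ, 0 < C0 ∧
        DiracMag.FormBound α β μs μ c v W χ ε1 0 C0) := by
  have hμ0 : 0 < μ := hμ.1
  have hμs0 := hW.μs_nonneg
  obtain ⟨C2, hC2, h2⟩ := DiracMag.exists_potential_form_bound hα hμ hδ hj0 hc hcμ hccμ hδμ hδδμ hχ
  -- Here a is the coefficient of A² in the bound on v_β², and κ/μ is the share of H₀² spent on the
  -- local singularities. The total coefficient of H₀² is therefore (a + κ)/μ.
  have hassemble : ∀ a κ C1 : ℝ, 0 ≤ a → 0 ≤ κ → 0 ≤ C1 → ∀ φ, DiracMag.Core φ →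
      (∀ j : ℤ, DiracMag.channelMul (DiracMag.vBeta β v) φ j ≤
        ENNReal.ofReal a * DiracMag.channelMul (DiracMag.potA α) φ j +
        ENNReal.ofReal (κ / μ) * DiracMag.channelDirac α φ j +
        ENNReal.ofReal C1 * DiracMag.channelNorm φ j) →
      DiracMag.formDiagSq (fun _ => DiracMag.vBeta β v) φ ≤
        ENNReal.ofReal ((a + κ) / μ) * DiracMag.formDiracSq α φ +
        ENNReal.ofReal a * DiracMag.formDiagSq (fun j r => DiracMag.lam α c j * χ j r) φ +
        ENNReal.ofReal (C1 + a * C2 + 1) * DiracMag.formDiagSq (fun _ _ => 1) φ :=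
    fun a κ C1 ha hκ hC1 φ hφ h1 =>
      DiracMag.form_bound_of_channel_bounds hα ha hκ hμ0 hC1 hC2 hφ h1 (h2 φ hφ)
  refine ⟨fun εs hεs ε1 hε1 => ?_, fun ⟨K, hK⟩ => ?_, fun hω ε1 hε1 => ?_⟩
  · obtain ⟨R, hR, hvR⟩ := hW.exists_vBeta_sq_le hεs.1
    have ha : 0 ≤ μs + εs := add_nonneg hμs0 hεs.1.le
    obtain ⟨C1, hC1, h1⟩ := DiracMag.exists_channelMul_bound (K := 0) hα ha le_rfl hR
      (div_pos hε1.1 hμ0) (DiracMag.memLp_vBeta (β := β) (hW.locSq_v R))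
      (fun r hr => by simpa using hvR r hr)
    refine ⟨C1 + (μs + εs) * C2 + 1, by positivity, fun φ hφ => ⟨hW.formMulSq_le hφ, ?_⟩⟩
    have h := hassemble (μs + εs) ε1 C1 ha hε1.1.le hC1 φ hφ (h1 φ hφ)
    rwa [add_right_comm μs] at h
  · refine ⟨K ^ 2 + μs * C2 + 1, by positivity, fun φ hφ => ⟨hW.formMulSq_le hφ, ?_⟩⟩
    -- The domination v_β² ≤ μ_*A² + K² holds almost everywhere on (0, ∞), so no local part remains
    -- and κ = 0.
    have h := hassemble μs 0 (K ^ 2) hμs0 le_rfl (sq_nonneg K) φ hφ fun j => by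
      rw [zero_div, ENNReal.ofReal_zero, zero_mul, add_zero]
      exact DiracMag.channelMul_le_of_ae hα hμs0 (sq_nonneg K) subset_rfl
        (hK.mono fun r hr => DiracMag.vBeta_sq_le_of_omegaPart_le hr) hφ j
    simpa only [add_zero] using h
  -- Only ω < 1 far out is used; the rest is a local singularity, which costs ε₁.
  · have hlim : limsup (fun r : ℝ => ENNReal.ofReal |DiracMag.omegaPart α β μs v r|) atTop <
        ENNReal.ofReal 1 := by
      rw [hω]; simp
    obtain ⟨R, hR⟩ := eventually_atTop.1 (eventually_lt_of_limsup_lt hlim)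
    have hvR : ∀ r, max R 1 < r →
        DiracMag.vBeta β v r ^ 2 ≤ μs * DiracMag.potA α r ^ 2 + 1 ^ 2 := fun r hr => by
      have h := (ENNReal.ofReal_lt_ofReal_iff one_pos).1 (hR r ((le_max_left _ _).trans hr.le))
      exact DiracMag.vBeta_sq_le_of_omegaPart_le ((le_abs_self _).trans h.le)
    obtain ⟨C1, hC1, h1⟩ := DiracMag.exists_channelMul_bound hα hμs0 (sq_nonneg (1 : ℝ))
      (lt_max_of_lt_right one_pos) (div_pos hε1.1 hμ0)
      (DiracMag.memLp_vBeta (β := β) (hW.locSq_v (max R 1))) hvR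
    refine ⟨C1 + μs * C2 + 1, by positivity, fun φ hφ => ⟨hW.formMulSq_le hφ, ?_⟩⟩
    have h := hassemble μs ε1 C1 hμs0 hε1.1.le hC1 φ hφ (h1 φ hφ)
    simpa only [add_zero] using h
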